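/- Let $\mathbf k=(k_1,\dots,k_N)$ be a tuple of positive integers and $K=k_1+\cdots+k_N$. A Stirling permutation of the multiset $\{1^{k_1},\dots,N^{k_N}\}$ is an arrangement $\sigma$ of it such that $\sigma(s)\ge\sigma(i)$ whenever $i<s<j$ and $\sigma(i)=\sigma(j)$. An index $i$ is a descent of $\sigma$ if $i=K$, or $i<K$ and $\sigma(i)>\sigma(i+1)$. Let $A_{\mathbf k,i}$ be the number of Stirling permutations with exactly $i$ descents, and define $B_{\mathbf k}(m)$ and $b_{\mathbf k}(m)$ by $$\sum_{m\ge0}B_{\mathbf k}(m)x^m=\frac{\sum_{i=1}^{N}A_{\mathbf k,i}x^i}{(1-x)^{K+1}},\qquad \sum_{m\ge0}b_{\mathbf k}(m)x^m=\frac{\sum_{i=K-N+1}^{K}A_{\mathbf k,K+1-i}x^i}{(1-x)^{K+1}}.$$ Let $n\ge1$, $a\ge1$, $t\ge2$, and suppose that $\mathbf k$ has length $n$ and weight $(a,\dots,a;t,\dots,t;0)$, i.e. $\mathbf k$ is the concatenation of $n$ copies of $(1,\dots,1,t)$ with $a-1$ ones. Then for all integers $m\ge0$ $$B_{\mathbf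 k}(m)=S_{a,t}(n+m,m),\qquad b_{\mathbf k}(m)=s_{a,t}(m,m-n).$$ Here, for a family $\mathcal F$ of nonempty multisets (blocks), $\min(\mathcal F)$ is the set of minimal elements of the blocks, and $\mathcal F$ is segmented with respect to $U$ if for all $x<y<z$ in $U$ such that $x$ and $z$ lie in a common block, $y\in\min(\mathcal F)$. Write $[r]=\{1,\dots,r\}$. $S_{a,t}(r,m)$ is the number of $(a+1)$-tuples $(\pi_0,\pi_1,\dots,\pi_a)$ such that (a) $\pi_1,\dots,\pi_a$ are partitions of $[r]$ into $m$ nonempty blocks; (b) $\pi_0$ is a family of $m$ nonempty multisets, segmented with respect to $[r+1]$, whose merged multiset is contained in the multiset consisting of one copy of each element of $\min(\pi_0)$ and $t-2$ copies of each element of $[r+1]\setminus\min(\pi_0)$; (c) $\min(\pi_0)=\min(\pi_1)=\cdots=\min(\pi_a)$; (d) if $x=\min([r]\setminus\min(\pi_0))$ exists, then some block of $\pi_0$ contains both $1$ and exactly $t-2$ copies of $x$. $s_{a,t}(r,m)$ is the number of $(a+1)$-tuples $(\sigma_0,\sigma_1,\dots,\sigma_a)$ such that (a) $\sigma_1,\dots,\sigma_a$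 are permutations of $[r]$ with $m$ left-to-right minima; (b) $\sigma_0$ is a family of $m$ nonempty multisets, segmented with respect to $[r+1]$, whose merged multiset consists of exactly one copy of each element of $\min(\sigma_0)$ and exactly $t-2$ copies of each element of $[r+1]\setminus\min(\sigma_0)$, and in which copies of the same element lie in different blocks, except for the element $x$ in (d); (c) $\min(\sigma_0)=\mathrm{lmin}(\sigma_1)=\cdots=\mathrm{lmin}(\sigma_a)$, where $\mathrm{lmin}(\sigma)$ denotes the set of left-to-right minima (values) of $\sigma$; (d) if $x=\min([r]\setminus\min(\sigma_0))$ exists, then some block of $\sigma_0$ contains both $1$ and exactly $t-2$ copies of $x$. For $m<0$, $s_{a,t}(r,m)=0$. -/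

import Mathlib

open Finset

noncomputable section

namespace StirlingPoly

/-- The multiset `{1^{k_1}, …, N^{k_N}}` of type `k = (k_1, …, k_N)`. -/
def multisetOfType (k : List ℕ) : Multiset ℕ :=
  ∑ i : Fin k.length, Multiset.replicate (k.get i) (i.1 + 1)

/-- The word `w` is a Stirling permutation of the multiset of type `k`: it is an arrangement of
this multiset, and all letters between two equal letters are at least as large as these. -/
def IsStirlingPerm (k w : List ℕ) : Prop :=
  (w : Multiset ℕ) = multisetOfType k ∧
    ∀ i s j : Fin w.length, i < s → s < j → w.get i = w.get j → w.get i ≤ w.get s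

/-- The number of descents of a word; the last position always counts as a descent. -/
def desCount (w : List ℕ) : ℕ :=
  #{i : Fin w.length | ∀ h : i.1 + 1 < w.length, w.get ⟨i.1 + 1, h⟩ < w.get i}

/-- The Eulerian number `A_{k,i}`. -/
def eulerian (k : List ℕ) (i : ℕ) : ℕ :=
  Set.ncard {w : List ℕ | IsStirlingPerm k w ∧ desCount w = i}

/-- `G_k(x) = (∑_{i=1}^{N} A_{k,i} x^i) / (1-x)^{K+1}`, with `N` the number of entries of `k` and
`K` their sum. -/
def G (k : List ℕ) : PowerSeries ℚ :=
  (∑ i ∈ Icc 1 k.length, (eulerian k i : PowerSeries ℚ) * PowerSeries.X ^ i) *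
    ((1 - PowerSeries.X) ^ (k.sum + 1))⁻¹

/-- `g_k(x) = (∑_{i=K-N+1}^{K} A_{k,K+1-i} x^i) / (1-x)^{K+1}`. -/
def g (k : List ℕ) : PowerSeries ℚ :=
  (∑ i ∈ Icc (k.sum - k.length + 1) k.sum,
      (eulerian k (k.sum + 1 - i) : PowerSeries ℚ) * PowerSeries.X ^ i) *
    ((1 - PowerSeries.X) ^ (k.sum + 1))⁻¹

/-- The Stirling polynomial `B_k` at `m`. -/
def B (k : List ℕ) (m : ℕ) : ℚ := PowerSeries.coeff m (G k)

/-- The Stirling polynomial `b_k` at `m`. -/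
def b (k : List ℕ) (m : ℕ) : ℚ := PowerSeries.coeff m (g k)

/-- `k` has length `l` and weight `(a_1, …, a_l; t_1, …, t_l; e)`: it is the concatenation of the
`a_i`-series `(1, …, 1, t_i)` (with `a_i - 1` ones), followed by `e` ones. -/
def HasWeight {l : ℕ} (k : List ℕ) (a t : Fin l → ℕ) (e : ℕ) : Prop :=
  (∀ i, 0 < a i ∧ 1 < t i) ∧
    k = (List.ofFn fun i => List.replicate (a i - 1) 1 ++ [t i]).flatten ++ List.replicate e 1

/-- The minimal element of a nonempty multiset. -/
def blockMin (C : Multiset ℕ) : ℕ := sInf {x | x ∈ C}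

/-- `min(F)`, the set of the minimal elements of the blocks of a family `F`. -/
def mins (F : Finset (Multiset ℕ)) : Finset ℕ := F.image blockMin

/-- The blocks of a set partition, as a family of multisets. -/
def blocks {N : ℕ} (P : Finpartition (Icc 1 N)) : Finset (Multiset ℕ) := P.parts.image Finset.val

/-- `x ∼_F y`: some block of `F` contains both `x` and `y`. -/
def Rel (F : Finset (Multiset ℕ)) (x y : ℕ) : Prop := ∃ C ∈ F, x ∈ C ∧ y ∈ C

/-- The family `F` is segmented with respect to the ground set `U`. -/
def IsSegmented (U : Finset ℕ) (F : Finset (Multiset ℕ)) : Prop :=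
  ∀ x ∈ U, ∀ y ∈ U, ∀ z ∈ U, x < y → y < z → Rel F x z → y ∈ mins F

/-- One copy of each element of `M`, and `t - 2` copies of each other element of
`{1, …, N + 1}`. -/
def ground (t N : ℕ) (M : Finset ℕ) : Multiset ℕ := M.val + (t - 2) • (Icc 1 (N + 1) \ M).val

/-- If `x` is the least element of `{1, …, N}` outside `min(F)`, then `t - 2` copies of `x` lie in
the same block of `F` as `1`. -/
def FirstWithOne (t N : ℕ) (F : Finset (Multiset ℕ)) : Prop :=
  ∀ x, IsLeast (↑(Icc 1 N \ mins F) : Set ℕ) x → ∃ C ∈ F, 1 ∈ C ∧ C.count x = t - 2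

/-- `S_{a,t}(N, m)`: the number of tuples `(π_0, (π_1, …, π_a))`, where `π_1, …, π_a` are set
partitions of `{1, …, N}` into `m` blocks and `π_0` is a segmented family of `m` nonempty multisets
partitioning a sub-multiset of `ground`, all with the same minima. -/
def S (a t N m : ℕ) : ℕ :=
  Set.ncard {p : Finset (Multiset ℕ) × (Fin a → Finpartition (Icc 1 N)) |
    (∀ j, #(p.2 j).parts = m) ∧
    (∀ j, mins (blocks (p.2 j)) = mins p.1) ∧
    #p.1 = m ∧ 0 ∉ p.1 ∧ IsSegmented (Icc 1 (N + 1)) p.1 ∧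
    (∑ C ∈ p.1, C) ≤ ground t N (mins p.1) ∧
    FirstWithOne t N p.1}

/-- The set of left-to-right minima of a permutation of `{1, …, N}`, written with `Fin N` for the
positions and for the values decreased by one. -/
def lmin {N : ℕ} (σ : Equiv.Perm (Fin N)) : Finset ℕ :=
  ({p : Fin N | ∀ q < p, σ p < σ q} : Finset (Fin N)).image fun p => (σ p : ℕ) + 1

/-- `s_{a,t}(N, r)`: the number of tuples `(σ_0, (σ_1, …, σ_a))`, where `σ_1, …, σ_a` are
permutations of `{1, …, N}` with `r` left-to-right minima, `σ_0` is a segmented family of `r`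
nonempty multisets partitioning the whole of `ground`, whose minima are the left-to-right minima
of all the `σ_j`, and distinct copies of an element lie in distinct blocks of `σ_0` (except for the
least element of `{1, …, N}` that is not a left-to-right minimum).
It is zero for negative `r`. -/
def s (a t N : ℕ) (r : ℤ) : ℕ :=
  Set.ncard {p : Finset (Multiset ℕ) × (Fin a → Equiv.Perm (Fin N)) |
    (∀ j, (#(lmin (p.2 j)) : ℤ) = r) ∧
    (∀ j, lmin (p.2 j) = mins p.1) ∧
    (#p.1 : ℤ) = r ∧ 0 ∉ p.1 ∧ IsSegmented (Icc 1 (N + 1)) p.1 ∧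
    (∑ C ∈ p.1, C) = ground t N (mins p.1) ∧
    FirstWithOne t N p.1 ∧
    ∀ C ∈ p.1, ∀ y ∈ C, ¬ IsLeast (↑(Icc 1 N \ mins p.1) : Set ℕ) y → C.count y ≤ 1}

end StirlingPoly

end

open Finset

namespace StirlingPoly

/-! ### Descents of words and insertion of a run of the largest letter -/

/-! Both sides satisfy the same recurrence in the number of series `(1, …, 1, t)`.

Analytic side. The copies of the largest letter in a Stirling permutation are consecutive, so every
Stirling permutation of `k ++ [t]` arises exactly once by inserting a run into one of type `k`. Of
the `K + 1` gaps in a word with `d` descents, `d` preserve the descent number and the others raise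
it by one (`sum_des_insertRun`). After division by `(1 - X) ^ (K + 1)` this says that a letter `t`
acts on the series by `X * d/dX` followed by multiplication by `geom ^ (t - 1)`, or by `(X * geom) ^
(t - 1)` in the reversed case. On coefficients, a whole series multiplies by `m ^ a` and then
convolves with binomial coefficients.

Combinatorial side. The tuples are sorted by the set `X`, of size `n`, of elements that are not
minima. Given `X`, the components are chosen independently. Each partition or permutation
contributes a product over `X` (`card_finpartition_mins_eq`, `card_perm_lmin_eq`). Segmentation and
the multiplicities force the block of `π_0` or `σ_0` with minimum `y` to be `y` together with copies
of the next element of `X ∪ {N + 1}` (`exists_eq_segFamily`). Such a family is a function on the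
minima, constrained separately on each gap between consecutive elements of `X ∪ {N + 1}`; a gap of
size `d` contributes `(d + t - 2).choose (t - 2)` for `S` and `d.choose (t - 2)` for `s`. The first
gap contributes 1, since 1 takes all copies of `min X`. Removing the largest element of `X` gives
the same convolution as on the analytic side (`sumS_succ`, `sumSmall_succ`). -/

/-- The number of descents of a word, by recursion on the word. -/
def des : List ℕ → ℕ
  | [] => 0
  | x :: l => (if ∀ y ∈ l.head?, y < x then 1 else 0) + des l

theorem desCount_eq_des (w : List ℕ) : desCount w = des w := by
  induction w with
  | nil => simp [desCount, des]
  | cons x l ih =>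
    unfold desCount at ih ⊢
    rw [des, ← ih]
    have := Fin.card_filter_univ_succ (n := l.length)
      (fun i : Fin (l.length + 1) => ∀ h : i.1 + 1 < (x :: l).length,
        (x :: l).get ⟨i.1 + 1, h⟩ < (x :: l).get i)
    refine this.trans ?_
    have h0 : (∀ h : (0 : Fin (l.length + 1)).1 + 1 < (x :: l).length,
        (x :: l).get ⟨(0 : Fin (l.length + 1)).1 + 1, h⟩ < (x :: l).get (0 : Fin (l.length + 1)))
        ↔ ∀ y ∈ l.head?, y < x := by
      cases l with
      | nil => exact ⟨fun _ => by simp, fun _ h => absurd h (by simp)⟩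
      | cons y l => simp
    have h1 : (#{i : Fin l.length | ∀ h : i.succ.1 + 1 < (x :: l).length,
        (x :: l).get ⟨i.succ.1 + 1, h⟩ < (x :: l).get i.succ}) =
        #{i : Fin l.length | ∀ h : i.1 + 1 < l.length, l.get ⟨i.1 + 1, h⟩ < l.get i} := by
      congr 1
      ext i
      simp
    simp only [h1]
    by_cases h : ∀ y ∈ l.head?, y < x
    · rw [if_pos (h0.2 h), if_pos h, add_comm]
    · rw [if_neg (fun h' => h (h0.1 h')), if_neg h, zero_add]

theorem des_le_length (w : List ℕ) : des w ≤ w.length := by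
  induction w with
  | nil => simp [des]
  | cons x l ih => rw [des, List.length_cons]; split_ifs <;> omega

theorem des_pos {w : List ℕ} (hw : w ≠ []) : 0 < des w := by
  induction w with
  | nil => exact absurd rfl hw
  | cons x l ih =>
    rw [des]
    cases l with
    | nil => simp
    | cons y l => have := ih (by simp); omega

/-- Insertion of `t` consecutive copies of `c` after the first `p` letters of `w`. -/
def insertRun (c t : ℕ) (w : List ℕ) (p : ℕ) : List ℕ :=
  w.take p ++ (List.replicate t c ++ w.drop p)

theorem des_replicate_append {c : ℕ} {t : ℕ} (ht : 0 < t) {l : List ℕ} (hl : ∀ x ∈ l, x < c) :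
    des (List.replicate t c ++ l) = 1 + des l := by
  induction t with
  | zero => omega
  | succ t ih =>
    rw [List.replicate_succ, List.cons_append, des]
    rcases Nat.eq_zero_or_pos t with rfl | h
    · rw [if_pos]
      · simp
      · intro y hy
        exact hl y (List.mem_of_mem_head? (by simpa using hy))
    · rw [if_neg, ih h, zero_add]
      obtain ⟨t, rfl⟩ : ∃ s, t = s + 1 := ⟨t - 1, by omega⟩
      simp [List.replicate_succ]

/-- The run always ends in a descent. In a gap just after a descent (the end of the word included)
it destroys that descent, so the total is unchanged; in any other gap the total grows by one. A
general weight `f` lets the induction absorb the contribution of the head by a shift. -/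
theorem sum_des_insertRun {c t : ℕ} (ht : 0 < t) {R : Type*} [CommSemiring R] (f : ℕ → R)
    {w : List ℕ} (hw : ∀ x ∈ w, x < c) :
    ∑ p ∈ range (w.length + 1), f (des (insertRun c t w p)) =
      des w * f (des w) + (w.length + 1 - des w : ℕ) * f (des w + 1) := by
  induction w generalizing f with
  | nil =>
    have := des_replicate_append (c := c) ht (l := []) (by simp)
    simp [insertRun, des] at this ⊢
    rw [this]
  | cons x l ih =>
    have hl : ∀ y ∈ l, y < c := fun y hy => hw y (by simp [hy])
    have hx : x < c := hw x (by simp)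
    have h0 : des (insertRun c t (x :: l) 0) = 1 + des (x :: l) := by
      simpa [insertRun] using des_replicate_append ht hw
    have h1 : des (insertRun c t (x :: l) 1) = 1 + des l := by
      have : insertRun c t (x :: l) 1 = x :: (List.replicate t c ++ l) := by simp [insertRun]
      rw [this, des, des_replicate_append ht hl, if_neg, zero_add]
      obtain ⟨t, rfl⟩ : ∃ s, t = s + 1 := ⟨t - 1, by omega⟩
      simp [List.replicate_succ, hx.le]
    -- `δ` is the contribution of the head `x`. It survives every insertion further right, but is
    -- lost when the run directly follows `x`.
    set δ : ℕ := if ∀ y ∈ l.head?, y < x then 1 else 0 with hδ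
    have hD : des (x :: l) = δ + des l := rfl
    have h2 : ∀ p ∈ range l.length, f (des (insertRun c t (x :: l) (p + 1 + 1))) =
        f (δ + des (insertRun c t l (p + 1))) := by
      intro p hp
      cases l with
      | nil => simp at hp
      | cons y l =>
        congr 1
    have hlen := des_le_length l
    have IH := ih (fun d => f (δ + d)) hl
    rw [sum_range_succ'] at IH
    have h3 : des (insertRun c t l 0) = 1 + des l := by
      simpa [insertRun] using des_replicate_append ht hl
    rw [h3] at IH
    rw [List.length_cons, sum_range_succ', sum_range_succ', sum_congr rfl h2, h0, zero_add, h1, hD]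
    have hδ01 : δ = 0 ∨ δ = 1 := by rw [hδ]; split_ifs <;> simp
    obtain ⟨e, he⟩ := Nat.exists_eq_add_of_le hlen
    rcases hδ01 with h | h
    · rw [h] at IH ⊢
      simp only [zero_add] at IH ⊢
      have e1 : l.length + 1 - des l = e + 1 := by omega
      have e2 : l.length + 1 + 1 - des l = e + 2 := by omega
      rw [e1] at IH
      rw [e2, add_comm 1 (des l)]
      rw [add_comm 1 (des l)] at IH
      rw [IH]; push_cast; ring
    · rw [h] at IH ⊢
      have e1 : l.length + 1 - des l = e + 1 := by omega
      have e2 : l.length + 1 + 1 - (1 + des l) = e + 1 := by omega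
      rw [e1] at IH
      rw [e2]
      have e3 : 1 + (1 + des l) = 1 + des l + 1 := by omega
      have e4 : 1 + (des l + 1) = 1 + des l + 1 := by omega
      rw [e3] at IH ⊢
      rw [e4] at IH
      rw [add_right_comm, IH]; push_cast; ring

theorem filter_insertRun {c t : ℕ} {w : List ℕ} (hw : c ∉ w) (p : ℕ) :
    (insertRun c t w p).filter (· ≠ c) = w := by
  have h1 : ∀ v : List ℕ, c ∉ v → v.filter (· ≠ c) = v := fun v hv =>
    List.filter_eq_self.2 fun x hx => by
      simp only [decide_eq_true_eq]; rintro rfl; exact hv hx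
  rw [insertRun, List.filter_append, List.filter_append, h1 _ fun h => hw (List.mem_of_mem_take h),
    h1 _ fun h => hw (List.mem_of_mem_drop h)]
  simp

/-- Deleting the letters `c` recovers the word, and the first occurrence of `c` recovers the
position. -/
theorem insertRun_injective {c t : ℕ} (ht : 0 < t) {w w' : List ℕ} (hw : c ∉ w) (hw' : c ∉ w')
    {p p' : ℕ} (hp : p ≤ w.length) (hp' : p' ≤ w'.length)
    (h : insertRun c t w p = insertRun c t w' p') : w = w' ∧ p = p' := by
  have e : w = w' := by rw [← filter_insertRun hw p, h, filter_insertRun hw' p']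
  subst e
  refine ⟨rfl, ?_⟩
  have key : ∀ q ≤ w.length, (insertRun c t w q).idxOf c = q := by
    intro q hq
    obtain ⟨t, rfl⟩ : ∃ s, t = s + 1 := ⟨t - 1, by omega⟩
    rw [insertRun, List.idxOf_append_of_notMem fun h => hw (List.mem_of_mem_take h)]
    simp [List.replicate_succ, hq]
  rw [← key p hp, h, key p' hp']

/-! ### Stirling permutations -/

/-- All letters between two equal letters are at least as large as these. -/
def StirlingWord (w : List ℕ) : Prop := ∀ x s, [x, s, x].Sublist w → x ≤ s

theorem stirlingWord_iff (w : List ℕ) : StirlingWord w ↔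
    ∀ i s j : Fin w.length, i < s → s < j → w.get i = w.get j → w.get i ≤ w.get s := by
  constructor
  · intro h i s j his hsj e
    have := List.map_getElem_sublist (l := w) (is := [i, s, j])
      (by simp [his, hsj, his.trans hsj])
    refine h _ _ ?_
    change [w.get i, w.get s, w.get j].Sublist w at this
    rwa [← e] at this
  · intro h x s hx
    obtain ⟨f, hf⟩ := List.sublist_iff_exists_fin_orderEmbedding_get_eq.1 hx
    have h0 := hf ⟨0, by simp⟩
    have h1 := hf ⟨1, by simp⟩
    have h2 := hf ⟨2, by simp⟩
    have := h (f ⟨0, by simp⟩) (f ⟨1, by simp⟩) (f ⟨2, by simp⟩) (f.lt_iff_lt.2 (by simp))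
      (f.lt_iff_lt.2 (by simp)) (by rw [← h0, ← h2]; rfl)
    rw [← h0, ← h1] at this
    exact this

theorem StirlingWord.sublist {w w' : List ℕ} (h : StirlingWord w) (h' : w'.Sublist w) :
    StirlingWord w' := fun x s hx => h x s (hx.trans h')

theorem cons_sublist_of_notMem {c : ℕ} {l u v : List ℕ} (hu : c ∉ u)
    (h : (c :: l).Sublist (u ++ v)) : (c :: l).Sublist v := by
  induction u with
  | nil => simpa using h
  | cons a u ih =>
    simp only [List.mem_cons, not_or] at hu
    rw [List.cons_append, List.cons_sublist_cons'] at h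
    rcases h with h | h
    · exact ih hu.2 h
    · exact absurd h.1 hu.1

theorem StirlingWord.insertRun {c t : ℕ} {w : List ℕ} (hw : StirlingWord w)
    (hc : ∀ x ∈ w, x < c) (p : ℕ) : StirlingWord (insertRun c t w p) := by
  have hcw : c ∉ w := fun h => lt_irrefl _ (hc c h)
  intro x s h
  have hmem : ∀ y ∈ StirlingPoly.insertRun c t w p, y ≤ c := by
    intro y hy
    simp only [StirlingPoly.insertRun, List.mem_append, List.mem_replicate] at hy
    rcases hy with hy | ⟨-, rfl⟩ | hy
    · exact (hc y (List.mem_of_mem_take hy)).le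
    · exact le_rfl
    · exact (hc y (List.mem_of_mem_drop hy)).le
  by_cases hs : s = c
  · rw [hs]; exact hmem x (h.subset (by simp))
  by_cases hx : x = c
  · subst hx
    exfalso
    have h1 := cons_sublist_of_notMem (fun h => hcw (List.mem_of_mem_take h)) h
    obtain ⟨l₁, l₂, e, h2, h3⟩ := List.sublist_append_iff.1 h1
    have hx2 : x ∉ l₂ := fun h => hcw (List.mem_of_mem_drop (h3.subset h))
    have hl1 : ∀ y ∈ l₁, y = x := fun y hy => List.eq_of_mem_replicate (h2.subset hy)
    match l₁, hl1 with
    | [], _ => apply hx2; rw [List.nil_append] at e; rw [← e]; simp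
    | [_], _ =>
      apply hx2
      simp only [List.cons_append, List.nil_append, List.cons.injEq] at e
      rw [← e.2]; simp
    | a :: b :: l, hl1 =>
      simp only [List.cons_append, List.cons.injEq] at e
      exact hs (e.2.1.trans (hl1 b (by simp)))
  · refine hw x s ?_
    have := h.filter (· ≠ c)
    rwa [filter_insertRun hcw, List.filter_eq_self.2] at this
    simp [hx, hs]

/-- A letter other than the maximum `c` between two copies of `c` would be smaller than `c`, which
is forbidden; hence the copies of `c` are consecutive. -/
theorem StirlingWord.exists_eq_insertRun {c t : ℕ} (ht : 0 < t) {w : List ℕ}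
    (hw : StirlingWord w) (hc : ∀ x ∈ w, x ≤ c) (hcount : w.count c = t) :
    ∃ v p, c ∉ v ∧ p ≤ v.length ∧ w = StirlingPoly.insertRun c t v p := by
  have hmem : c ∈ w := List.count_pos_iff.1 (by omega)
  obtain ⟨u, r, e, hu⟩ := List.eq_append_cons_of_mem hmem
  -- After its first occurrence, `c` continues as a run and then never returns.
  have hr : ∃ s v, r = List.replicate s c ++ v ∧ c ∉ v := by
    have h1 : (c :: r).Sublist w := by rw [e]; exact List.sublist_append_right _ _
    clear e hcount
    induction r with
    | nil => exact ⟨0, [], by simp⟩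
    | cons a r ih =>
      by_cases hac : a = c
      · subst hac
        obtain ⟨s, v, h2, h3⟩ := ih ((List.sublist_cons_self _ _).trans h1)
        exact ⟨s + 1, v, by rw [h2, List.replicate_succ, List.cons_append], h3⟩
      · refine ⟨0, a :: r, by simp, fun h => ?_⟩
        have h2 : c ∈ r := by
          rcases List.mem_cons.1 h with h | h
          · exact absurd h.symm hac
          · exact h
        have h3 : [c, a, c].Sublist w :=
          (List.Sublist.cons_cons c (List.Sublist.cons_cons a
            (List.singleton_sublist.2 h2))).trans h1
        exact hac (le_antisymm (hc a (h3.subset (by simp))) (hw c a h3))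
  obtain ⟨s, v, rfl, hv⟩ := hr
  have hs : s + 1 = t := by
    rw [← hcount, e]
    simp [List.count_eq_zero_of_not_mem hu, List.count_eq_zero_of_not_mem hv]
  refine ⟨u ++ v, u.length, by simp [hu, hv], by simp, ?_⟩
  rw [e, ← hs]
  simp [StirlingPoly.insertRun, List.replicate_succ]

theorem multisetOfType_append (k : List ℕ) (t : ℕ) :
    multisetOfType (k ++ [t]) = multisetOfType k + Multiset.replicate t (k.length + 1) := by
  unfold multisetOfType
  have h : (k ++ [t]).length = k.length + 1 := by simp
  rw [← Equiv.sum_comp (finCongr h.symm), Fin.sum_univ_castSucc]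
  congr 1
  · refine sum_congr rfl fun i _ => ?_
    simp
  · simp

theorem mem_multisetOfType_le {k : List ℕ} {x : ℕ} (hx : x ∈ multisetOfType k) :
    x ≤ k.length := by
  unfold multisetOfType at hx
  rw [Multiset.mem_sum] at hx
  obtain ⟨i, -, hi⟩ := hx
  rw [Multiset.eq_of_mem_replicate hi]
  exact i.2

theorem card_multisetOfType (k : List ℕ) : (multisetOfType k).card = k.sum := by
  induction k using List.reverseRecOn with
  | nil => simp [multisetOfType]
  | append_singleton k t ih => rw [multisetOfType_append]; simp [ih]

/-- The finset of Stirling permutations of type `k`. -/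
noncomputable def stirlingPerms (k : List ℕ) : Finset (List ℕ) :=
  open Classical in (multisetOfType k).lists.toFinset.filter (IsStirlingPerm k)

theorem mem_stirlingPerms {k w : List ℕ} :
    w ∈ stirlingPerms k ↔ (w : Multiset ℕ) = multisetOfType k ∧ StirlingWord w := by
  simp only [stirlingPerms, mem_filter, Multiset.mem_toFinset, Multiset.mem_lists_iff, IsStirlingPerm, stirlingWord_iff]
  constructor
  · exact fun h => h.2
  · exact fun h => ⟨h.1.symm, h⟩

theorem length_of_mem_stirlingPerms {k w : List ℕ} (h : w ∈ stirlingPerms k) :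
    w.length = k.sum := by
  rw [← card_multisetOfType, ← (mem_stirlingPerms.1 h).1, Multiset.coe_card]

theorem lt_of_mem_stirlingPerms {k w : List ℕ} (h : w ∈ stirlingPerms k) {x : ℕ} (hx : x ∈ w) :
    x < k.length + 1 :=
  Nat.lt_succ_of_le (mem_multisetOfType_le (by rw [← (mem_stirlingPerms.1 h).1]; exact hx))

theorem stirlingPerms_nil : stirlingPerms [] = {[]} := by
  ext w
  rw [mem_stirlingPerms, mem_singleton]
  constructor
  · rintro ⟨h, -⟩
    simpa [multisetOfType] using h
  · rintro rfl
    exact ⟨by simp [multisetOfType], fun x s h => by simp at h⟩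

theorem coe_insertRun (c t : ℕ) (w : List ℕ) (p : ℕ) :
    (insertRun c t w p : Multiset ℕ) = (w : Multiset ℕ) + Multiset.replicate t c := by
  conv_rhs => rw [← List.take_append_drop p w]
  rw [insertRun, ← Multiset.coe_replicate]
  simp only [← Multiset.coe_add]
  abel

theorem sum_stirlingPerms_append {R : Type*} [CommSemiring R] (f : ℕ → R) (k : List ℕ) {t : ℕ}
    (ht : 0 < t) :
    ∑ w ∈ stirlingPerms (k ++ [t]), f (des w) =
      ∑ w ∈ stirlingPerms k,
        (des w * f (des w) + (k.sum + 1 - des w : ℕ) * f (des w + 1)) := by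
  have h1 : ∀ w ∈ stirlingPerms k,
      (des w * f (des w) + (k.sum + 1 - des w : ℕ) * f (des w + 1)) =
      ∑ p ∈ range (k.sum + 1), f (des (insertRun (k.length + 1) t w p)) := by
    intro w hw
    rw [← length_of_mem_stirlingPerms hw]
    exact (sum_des_insertRun ht f fun x hx => lt_of_mem_stirlingPerms hw hx).symm
  rw [sum_congr rfl h1, ← sum_product']
  have hnot : ∀ w ∈ stirlingPerms k, k.length + 1 ∉ w := fun w hw h =>
    lt_irrefl _ (lt_of_mem_stirlingPerms hw h)
  symm
  refine sum_bij (fun q _ => insertRun (k.length + 1) t q.1 q.2) ?_ ?_ ?_ fun _ _ => rfl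
  · rintro ⟨w, p⟩ h
    obtain ⟨hw, -⟩ := mem_product.1 h
    refine mem_stirlingPerms.2 ⟨?_, (mem_stirlingPerms.1 hw).2.insertRun
      (fun x hx => lt_of_mem_stirlingPerms hw hx) p⟩
    rw [coe_insertRun, multisetOfType_append, (mem_stirlingPerms.1 hw).1]
  · rintro ⟨w, p⟩ h ⟨w', p'⟩ h' e
    obtain ⟨hw, hp⟩ := mem_product.1 h
    obtain ⟨hw', hp'⟩ := mem_product.1 h'
    rw [mem_range] at hp hp'
    have := insertRun_injective ht (hnot w hw) (hnot w' hw')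
      (by rw [length_of_mem_stirlingPerms hw]; omega)
      (by rw [length_of_mem_stirlingPerms hw']; omega) e
    exact Prod.ext this.1 this.2
  · intro w hw
    obtain ⟨hm, hs⟩ := mem_stirlingPerms.1 hw
    rw [multisetOfType_append] at hm
    have h0 : k.length + 1 ∉ multisetOfType k := fun h => by
      have := mem_multisetOfType_le h; omega
    have hle : ∀ x ∈ w, x ≤ k.length + 1 := by
      intro x hx
      rw [← Multiset.mem_coe, hm, Multiset.mem_add, Multiset.mem_replicate] at hx
      rcases hx with hx | hx
      · exact (mem_multisetOfType_le hx).trans (Nat.le_succ _)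
      · exact hx.2.le
    have hc : w.count (k.length + 1) = t := by
      rw [← Multiset.coe_count, hm, Multiset.count_add, Multiset.count_eq_zero_of_notMem h0,
        Multiset.count_replicate_self, zero_add]
    obtain ⟨v, p, hv, hp, e⟩ := hs.exists_eq_insertRun ht hle hc
    have hvk : v ∈ stirlingPerms k := by
      refine mem_stirlingPerms.2 ⟨?_, ?_⟩
      · rw [e, coe_insertRun] at hm
        exact add_right_cancel hm
      · refine hs.sublist ?_
        rw [← filter_insertRun hv p (t := t), ← e]
        exact List.filter_sublist
    refine ⟨(v, p), mem_product.2 ⟨hvk, mem_range.2 ?_⟩, e.symm⟩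
    rw [← length_of_mem_stirlingPerms hvk]
    omega

theorem eulerian_eq_card (k : List ℕ) (i : ℕ) :
    eulerian k i = #{w ∈ stirlingPerms k | des w = i} := by
  rw [eulerian, ← Set.ncard_coe_finset]
  congr 1
  ext w
  simp [mem_stirlingPerms, IsStirlingPerm, stirlingWord_iff, desCount_eq_des]

theorem des_le_of_mem_stirlingPerms {k : List ℕ} (hk : ∀ t ∈ k, 0 < t) :
    ∀ w ∈ stirlingPerms k, des w ≤ k.length := by
  induction k using List.reverseRecOn with
  | nil => simp [stirlingPerms_nil, des]
  | append_singleton k t ih =>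
    have ih := ih fun t ht => hk t (by simp [ht])
    -- The weight is the indicator of having more than `k.length + 1` descents. By induction every
    -- term of the sum over type `k` vanishes, so every term of the sum over the longer type does
    -- too.
    have h := sum_stirlingPerms_append (fun d => if d ≤ k.length + 1 then 0 else 1) k
      (hk t (by simp))
    rw [sum_eq_zero (s := stirlingPerms k)] at h
    · intro w hw
      have := (sum_eq_zero_iff.1 h) w hw
      simpa using this
    · intro w hw
      have := ih w hw
      rw [if_pos (by omega), if_pos (by omega)]
      simp

/-! ### Generating functions -/

/-- The power series `1 / (1 - X)`. -/
def geom : PowerSeries ℚ := PowerSeries.mk 1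

theorem geom_mul_one_sub : geom * (1 - PowerSeries.X) = 1 :=
  PowerSeries.mk_one_mul_one_sub_eq_one ℚ

theorem derivative_geom : PowerSeries.derivative ℚ geom = geom ^ 2 := by
  unfold geom
  rw [PowerSeries.mk_one_pow_eq_mk_choose_add]
  ext n
  rw [PowerSeries.coeff_derivative]
  simp [add_comm]

theorem inv_one_sub_pow (n : ℕ) : ((1 - PowerSeries.X : PowerSeries ℚ) ^ n)⁻¹ = geom ^ n := by
  symm
  rw [PowerSeries.eq_inv_iff_mul_eq_one (by simp), ← mul_pow, geom_mul_one_sub, one_pow]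

/-- With `e` descents and `e + f = K + 1`, the coefficients `e` and `f` are exactly the numbers of
gaps that preserve or raise the descent number. -/
theorem X_mul_derivative_X_pow_mul_geom_pow (e f : ℕ) :
    PowerSeries.X * PowerSeries.derivative ℚ (PowerSeries.X ^ e * geom ^ (e + f)) =
      ((e : PowerSeries ℚ) * PowerSeries.X ^ e + (f : PowerSeries ℚ) * PowerSeries.X ^ (e + 1)) *
        geom ^ (e + f + 1) := by
  have h1 : PowerSeries.derivative ℚ (geom ^ (e + f)) =
      ((e + f : ℕ) : PowerSeries ℚ) * geom ^ (e + f + 1) := by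
    rw [Derivation.leibniz_pow, derivative_geom]
    rcases Nat.eq_zero_or_pos (e + f) with h | h
    · rw [h]; simp
    · obtain ⟨r, hr⟩ : ∃ r, e + f = r + 1 := ⟨e + f - 1, by omega⟩
      rw [hr]
      simp only [nsmul_eq_mul, smul_eq_mul, Nat.add_sub_cancel]
      ring
  have h2 : PowerSeries.X * PowerSeries.derivative ℚ (PowerSeries.X ^ e) =
      (e : PowerSeries ℚ) * PowerSeries.X ^ e := by
    rw [Derivation.leibniz_pow, PowerSeries.derivative_X]
    cases e with
    | zero => simp
    | succ e =>
      simp only [nsmul_eq_mul, smul_eq_mul, Nat.add_sub_cancel]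
      ring
  rw [Derivation.leibniz, smul_eq_mul, smul_eq_mul, h1]
  push_cast
  linear_combination geom ^ (e + f) * h2 -
    (e : PowerSeries ℚ) * PowerSeries.X ^ e * geom ^ (e + f) * geom_mul_one_sub

/-- The generating function of the descents of the Stirling permutations of type `k`, divided by
`(1 - X) ^ (K + 1)`. -/
noncomputable def desSeries (k : List ℕ) : PowerSeries ℚ :=
  (∑ w ∈ stirlingPerms k, PowerSeries.X ^ des w) * geom ^ (k.sum + 1)

/-- The reversed version of `desSeries`. -/
noncomputable def desSeriesRev (k : List ℕ) : PowerSeries ℚ :=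
  (∑ w ∈ stirlingPerms k, PowerSeries.X ^ (k.sum + 1 - des w)) * geom ^ (k.sum + 1)

theorem desSeries_append (k : List ℕ) (t : ℕ) :
    desSeries (k ++ [t + 1]) =
      PowerSeries.X * PowerSeries.derivative ℚ (desSeries k) * geom ^ t := by
  rw [desSeries, desSeries, sum_stirlingPerms_append (fun d => PowerSeries.X ^ d) k t.succ_pos,
    sum_mul, sum_mul, map_sum, mul_sum, sum_mul]
  refine sum_congr rfl fun w hw => ?_
  have h := des_le_length w
  rw [length_of_mem_stirlingPerms hw] at h
  obtain ⟨f, hf⟩ := Nat.exists_eq_add_of_le (h.trans (Nat.le_succ _))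
  have hs : (k ++ [t + 1]).sum + 1 = k.sum + 1 + 1 + t := by simp; ring
  have hf' : k.sum + 1 - des w = f := by omega
  rw [hs, hf', show k.sum + 1 = des w + f from hf, X_mul_derivative_X_pow_mul_geom_pow]
  ring

/-- Under reversal of exponents the two kinds of gaps exchange roles, and the `t` additional letters
leave a factor `X ^ t`. -/
theorem desSeriesRev_append (k : List ℕ) (t : ℕ) :
    desSeriesRev (k ++ [t + 1]) =
      PowerSeries.X ^ t * (PowerSeries.X * PowerSeries.derivative ℚ (desSeriesRev k)) *
        geom ^ t := by
  rw [desSeriesRev, desSeriesRev,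
    sum_stirlingPerms_append (fun d => PowerSeries.X ^ ((k ++ [t + 1]).sum + 1 - d)) k t.succ_pos,
    sum_mul, sum_mul, map_sum, mul_sum, mul_sum, sum_mul]
  refine sum_congr rfl fun w hw => ?_
  have h := des_le_length w
  rw [length_of_mem_stirlingPerms hw] at h
  obtain ⟨f, hf⟩ := Nat.exists_eq_add_of_le (h.trans (Nat.le_succ _))
  have hs : (k ++ [t + 1]).sum + 1 = f + des w + 1 + t := by simp; omega
  have hf' : k.sum + 1 - des w = f := by omega
  rw [hs, hf', show k.sum + 1 = f + des w by omega, X_mul_derivative_X_pow_mul_geom_pow,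
    show f + des w + 1 + t - des w = f + 1 + t by omega,
    show f + des w + 1 + t - (des w + 1) = f + t by omega]
  ring

/-- Descent numbers lie between 1 and the number of letters, so the truncated sum defining `G` loses
no word. -/
theorem G_eq_desSeries {k : List ℕ} (hk : ∀ t ∈ k, 0 < t) (h0 : k ≠ []) :
    G k = desSeries k := by
  rw [G, desSeries, inv_one_sub_pow]
  congr 1
  have hmaps : ∀ w ∈ stirlingPerms k, des w ∈ Icc 1 k.length := by
    intro w hw
    refine mem_Icc.2 ⟨des_pos ?_, des_le_of_mem_stirlingPerms hk w hw⟩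
    rintro rfl
    have := length_of_mem_stirlingPerms hw
    obtain ⟨t, l, rfl⟩ := List.exists_cons_of_ne_nil h0
    have := hk t (by simp)
    simp at *
    omega
  rw [← sum_fiberwise_of_maps_to hmaps]
  refine sum_congr rfl fun i _ => ?_
  rw [eulerian_eq_card, sum_congr rfl (g := fun _ => PowerSeries.X ^ i)
    fun w hw => by rw [(mem_filter.1 hw).2]]
  simp

theorem g_eq_desSeriesRev {k : List ℕ} (hk : ∀ t ∈ k, 0 < t) (h0 : k ≠ []) :
    g k = desSeriesRev k := by
  rw [g, desSeriesRev, inv_one_sub_pow]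
  congr 1
  -- The bound by `k.sum` keeps the truncated subtraction `k.sum + 1 - des w` faithful and positive.
  have hdes : ∀ w ∈ stirlingPerms k, 1 ≤ des w ∧ des w ≤ k.length ∧ des w ≤ k.sum := by
    intro w hw
    refine ⟨des_pos ?_, des_le_of_mem_stirlingPerms hk w hw, ?_⟩
    · rintro rfl
      have := length_of_mem_stirlingPerms hw
      obtain ⟨t, l, rfl⟩ := List.exists_cons_of_ne_nil h0
      have := hk t (by simp)
      simp at *
      omega
    · rw [← length_of_mem_stirlingPerms hw]; exact des_le_length w
  have hmaps : ∀ w ∈ stirlingPerms k, k.sum + 1 - des w ∈ Icc (k.sum - k.length + 1) k.sum := by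
    intro w hw
    have := hdes w hw
    rw [mem_Icc]; omega
  rw [← sum_fiberwise_of_maps_to hmaps]
  refine sum_congr rfl fun i hi => ?_
  rw [mem_Icc] at hi
  rw [eulerian_eq_card, sum_congr rfl (g := fun _ => PowerSeries.X ^ i)
    fun w hw => by rw [(mem_filter.1 hw).2]]
  simp only [sum_const, nsmul_eq_mul]
  congr 3
  refine filter_congr fun w hw => ?_
  have := hdes w hw
  omega

/-! ### Coefficient recurrences for the two series -/

theorem coeff_X_mul_derivative (f : PowerSeries ℚ) (m : ℕ) :
    PowerSeries.coeff m (PowerSeries.X * PowerSeries.derivative ℚ f) =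
      m * PowerSeries.coeff m f := by
  cases m with
  | zero => simp
  | succ m =>
    rw [PowerSeries.coeff_succ_X_mul, PowerSeries.coeff_derivative]
    push_cast; ring

theorem coeff_desSeries_replicate (k : List ℕ) (a m : ℕ) :
    PowerSeries.coeff m (desSeries (k ++ List.replicate a 1)) =
      (m : ℚ) ^ a * PowerSeries.coeff m (desSeries k) := by
  induction a with
  | zero => simp
  | succ a ih =>
    rw [List.replicate_succ', ← List.append_assoc, desSeries_append _ 0, pow_zero, mul_one,
      coeff_X_mul_derivative, ih]
    ring

theorem coeff_desSeriesRev_replicate (k : List ℕ) (a m : ℕ) :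
    PowerSeries.coeff m (desSeriesRev (k ++ List.replicate a 1)) =
      (m : ℚ) ^ a * PowerSeries.coeff m (desSeriesRev k) := by
  induction a with
  | zero => simp
  | succ a ih =>
    rw [List.replicate_succ', ← List.append_assoc, desSeriesRev_append _ 0, pow_zero, pow_zero, mul_one,
      one_mul, coeff_X_mul_derivative, ih]
    ring

/-- Each of the `a + 1` letters applies `X * d/dX`, which multiplies the coefficient at `m` by `m`;
the factor `geom ^ (s + 1)` of the last letter is the convolution kernel. -/
theorem coeff_desSeries_block (k : List ℕ) (a s m : ℕ) :
    PowerSeries.coeff m (desSeries (k ++ (List.replicate a 1 ++ [s + 2]))) =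
      ∑ p ∈ antidiagonal m,
        (p.1 : ℚ) ^ (a + 1) * (p.2 + s).choose s * PowerSeries.coeff p.1 (desSeries k) := by
  rw [← List.append_assoc, desSeries_append, geom, PowerSeries.mk_one_pow_eq_mk_choose_add,
    PowerSeries.coeff_mul]
  refine sum_congr rfl fun p _ => ?_
  rw [coeff_X_mul_derivative, coeff_desSeries_replicate, PowerSeries.coeff_mk, add_comm s]
  ring

theorem X_pow_mul_geom_pow (s : ℕ) :
    (PowerSeries.X : PowerSeries ℚ) ^ (s + 1) * geom ^ (s + 1) =
      PowerSeries.X * PowerSeries.mk fun d => (d.choose s : ℚ) := by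
  rw [geom, PowerSeries.mk_one_pow_eq_mk_choose_add, pow_succ', mul_assoc]
  congr 1
  ext d
  rw [PowerSeries.coeff_X_pow_mul', PowerSeries.coeff_mk, PowerSeries.coeff_mk]
  split_ifs with h
  · rw [Nat.add_sub_cancel' h]
  · rw [Nat.choose_eq_zero_of_lt (by omega)]; simp

theorem desSeriesRev_block (k : List ℕ) (a s : ℕ) :
    desSeriesRev (k ++ (List.replicate a 1 ++ [s + 2])) =
      PowerSeries.X * ((PowerSeries.X *
        PowerSeries.derivative ℚ (desSeriesRev (k ++ List.replicate a 1))) *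
          PowerSeries.mk fun d => (d.choose s : ℚ)) := by
  rw [← List.append_assoc, desSeriesRev_append]
  linear_combination (PowerSeries.X *
        PowerSeries.derivative ℚ (desSeriesRev (k ++ List.replicate a 1))) * X_pow_mul_geom_pow s

theorem coeff_zero_desSeriesRev_block (k : List ℕ) (a s : ℕ) :
    PowerSeries.coeff 0 (desSeriesRev (k ++ (List.replicate a 1 ++ [s + 2]))) = 0 := by
  rw [desSeriesRev_block, PowerSeries.coeff_zero_X_mul]

/-- The kernel is `X` times the series of `d.choose s`; the extra `X` shifts the index by one. -/
theorem coeff_succ_desSeriesRev_block (k : List ℕ) (a s m : ℕ) :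
    PowerSeries.coeff (m + 1) (desSeriesRev (k ++ (List.replicate a 1 ++ [s + 2]))) =
      ∑ p ∈ antidiagonal m,
        (p.1 : ℚ) ^ (a + 1) * p.2.choose s * PowerSeries.coeff p.1 (desSeriesRev k) := by
  rw [desSeriesRev_block, PowerSeries.coeff_succ_X_mul, PowerSeries.coeff_mul]
  refine sum_congr rfl fun p _ => ?_
  rw [coeff_X_mul_derivative, coeff_desSeriesRev_replicate, PowerSeries.coeff_mk]
  ring

theorem coeff_desSeries_nil (m : ℕ) : PowerSeries.coeff m (desSeries []) = 1 := by
  simp [desSeries, stirlingPerms_nil, des, geom]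

/-- The empty word gives `X / (1 - X)`, whose constant coefficient is 0 rather than 1. -/
theorem coeff_succ_desSeriesRev_nil (m : ℕ) :
    PowerSeries.coeff (m + 1) (desSeriesRev []) = 1 := by
  simp [desSeriesRev, stirlingPerms_nil, des, geom, PowerSeries.coeff_succ_X_mul]

/-- The list consisting of `n` copies of `(1, …, 1, t)` with `a` ones. -/
def periodicList (a t n : ℕ) : List ℕ := (List.replicate n (List.replicate a 1 ++ [t])).flatten

theorem periodicList_succ (a t n : ℕ) :
    periodicList a t (n + 1) = periodicList a t n ++ (List.replicate a 1 ++ [t]) := by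
  simp [periodicList, List.replicate_succ']

theorem pos_of_mem_periodicList {a t n : ℕ} (ht : 0 < t) : ∀ x ∈ periodicList a t n, 0 < x := by
  intro x hx
  simp only [periodicList, List.mem_flatten, List.mem_replicate] at hx
  obtain ⟨l, ⟨-, rfl⟩, hx⟩ := hx
  simp only [List.mem_append, List.mem_replicate, List.mem_singleton] at hx
  omega

/-! ### Set partitions with prescribed block minima -/

theorem blockMin_mem {C : Multiset ℕ} (h : C ≠ 0) : blockMin C ∈ C := by
  obtain ⟨x, hx⟩ := Multiset.exists_mem_of_ne_zero h
  exact Nat.sInf_mem (s := {x | x ∈ C}) ⟨x, hx⟩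

theorem blockMin_le {C : Multiset ℕ} {x : ℕ} (h : x ∈ C) : blockMin C ≤ x :=
  Nat.sInf_le (s := {x | x ∈ C}) h

theorem blockMin_eq {C : Multiset ℕ} {y : ℕ} (hy : y ∈ C) (h : ∀ x ∈ C, y ≤ x) :
    blockMin C = y :=
  le_antisymm (blockMin_le hy) (h _ (blockMin_mem (by rintro rfl; simp at hy)))

theorem mem_mins {F : Finset (Multiset ℕ)} {y : ℕ} : y ∈ mins F ↔ ∃ C ∈ F, blockMin C = y :=
  mem_image

section Partitions

variable {N : ℕ}

/-- The minimum of the block of `x`. -/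
noncomputable def partMin (P : Finpartition (Icc 1 N)) (x : ℕ) : ℕ := blockMin (P.part x).val

theorem partMin_mem (P : Finpartition (Icc 1 N)) {x : ℕ} (hx : x ∈ Icc 1 N) :
    partMin P x ∈ P.part x :=
  blockMin_mem fun h => by
    have := P.mem_part hx
    rw [← Finset.mem_val, h] at this
    simp at this

theorem partMin_le (P : Finpartition (Icc 1 N)) {x : ℕ} (hx : x ∈ Icc 1 N) : partMin P x ≤ x :=
  blockMin_le (P.mem_part hx)

theorem mem_part_iff_partMin_eq (P : Finpartition (Icc 1 N)) {x y : ℕ} (hx : x ∈ Icc 1 N)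
    (hy : y ∈ Icc 1 N) : y ∈ P.part x ↔ partMin P y = partMin P x := by
  constructor
  · intro h
    have : P.part y = P.part x := P.part_eq_of_mem (P.part_mem.2 hx) h
    rw [partMin, partMin, this]
  · intro h
    have h1 := partMin_mem P hx
    have h2 := partMin_mem P hy
    rw [h] at h2
    have := P.eq_of_mem_parts (P.part_mem.2 hx) (P.part_mem.2 hy) h1 h2
    rw [this]
    exact P.mem_part hy

theorem mem_mins_blocks (P : Finpartition (Icc 1 N)) {y : ℕ} :
    y ∈ mins (blocks P) ↔ ∃ x ∈ Icc 1 N, partMin P x = y := by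
  rw [mem_mins]
  constructor
  · rintro ⟨C, hC, rfl⟩
    obtain ⟨A, hA, rfl⟩ := mem_image.1 hC
    obtain ⟨x, hx⟩ := P.nonempty_of_mem_parts hA
    exact ⟨x, P.le hA hx, by rw [partMin, P.part_eq_of_mem hA hx]⟩
  · rintro ⟨x, hx, rfl⟩
    exact ⟨_, mem_image_of_mem _ (P.part_mem.2 hx), rfl⟩

theorem mins_blocks_subset (P : Finpartition (Icc 1 N)) : mins (blocks P) ⊆ Icc 1 N := by
  intro y hy
  obtain ⟨x, hx, rfl⟩ := (mem_mins_blocks P).1 hy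
  exact P.part_subset x (partMin_mem P hx)

theorem partMin_eq_self (P : Finpartition (Icc 1 N)) {x : ℕ} (hx : x ∈ mins (blocks P)) :
    partMin P x = x := by
  have hx' := mins_blocks_subset P hx
  obtain ⟨z, hz, rfl⟩ := (mem_mins_blocks P).1 hx
  exact (mem_part_iff_partMin_eq P hz hx').1 (partMin_mem P hz)

theorem card_mins_blocks (P : Finpartition (Icc 1 N)) : #(mins (blocks P)) = #P.parts := by
  rw [mins, blocks, image_image, card_image_of_injOn]
  intro A hA B hB h
  have key : ∀ C ∈ P.parts, blockMin C.val ∈ C := fun C hC => by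
    obtain ⟨x, hx⟩ := P.nonempty_of_mem_parts hC
    exact blockMin_mem (C := C.val) fun h => by
      rw [← Finset.mem_val, h] at hx
      simp at hx
  have hB' := key B hB
  have h : blockMin A.val = blockMin B.val := h
  rw [← h] at hB'
  exact P.eq_of_mem_parts hA hB (key A hA) hB'

theorem eq_of_partMin_eq {P Q : Finpartition (Icc 1 N)}
    (h : ∀ x ∈ Icc 1 N, partMin P x = partMin Q x) : P = Q := by
  have hp : ∀ x ∈ Icc 1 N, P.part x = Q.part x := by
    intro x hx
    ext y
    by_cases hy : y ∈ Icc 1 N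
    · rw [mem_part_iff_partMin_eq P hx hy, mem_part_iff_partMin_eq Q hx hy, h x hx, h y hy]
    · exact ⟨fun h => absurd (P.part_subset x h) hy, fun h => absurd (Q.part_subset x h) hy⟩
  have sub : ∀ P Q : Finpartition (Icc 1 N), (∀ x ∈ Icc 1 N, P.part x = Q.part x) →
      P.parts ⊆ Q.parts := by
    intro P Q hp A hA
    obtain ⟨x, hx⟩ := P.nonempty_of_mem_parts hA
    have hx' := P.le hA hx
    rw [← P.part_eq_of_mem hA hx, hp x hx']
    exact Q.part_mem.2 hx'
  exact Finpartition.ext (subset_antisymm (sub P Q hp) (sub Q P fun x hx => (hp x hx).symm))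

theorem exists_finpartition_partMin_eq (f : ℕ → ℕ) (hf : ∀ x ∈ Icc 1 N, f x ∈ Icc 1 N)
    (hle : ∀ x ∈ Icc 1 N, f x ≤ x) (hff : ∀ x ∈ Icc 1 N, f (f x) = f x) :
    ∃ P : Finpartition (Icc 1 N), ∀ x ∈ Icc 1 N, partMin P x = f x := by
  classical
  refine ⟨Finpartition.ofSetSetoid (Setoid.ker f) (Icc 1 N), fun x hx => ?_⟩
  refine blockMin_eq ?_ ?_
  · rw [Finset.mem_val, Finpartition.mem_part_ofSetSetoid_iff_rel]
    exact ⟨hx, hf x hx, (hff x hx).symm⟩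
  · intro y hy
    rw [Finset.mem_val, Finpartition.mem_part_ofSetSetoid_iff_rel] at hy
    have : f x = f y := hy.2.2
    rw [this]
    exact hle y hy.2.1

/-- A partition amounts to the function sending each element to the minimum of its block. Minima are
fixed, and each `x ∈ X` independently chooses any smaller element outside `X`. -/
theorem card_finpartition_mins_eq {X : Finset ℕ} (hX : X ⊆ Icc 1 N) :
    Nat.card {P : Finpartition (Icc 1 N) // mins (blocks P) = Icc 1 N \ X} =
      ∏ x ∈ X, #{y ∈ Ico 1 x | y ∉ X} := by
  have hmem : ∀ P : Finpartition (Icc 1 N), mins (blocks P) = Icc 1 N \ X → ∀ x ∈ X,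
      partMin P x ∈ (Ico 1 x).filter (· ∉ X) := by
    intro P hP x hx
    have h1 : partMin P x ∈ mins (blocks P) := (mem_mins_blocks P).2 ⟨x, hX hx, rfl⟩
    have h2 := partMin_le P (hX hx)
    rw [hP, mem_sdiff, mem_Icc] at h1
    rw [mem_filter, mem_Ico]
    refine ⟨⟨h1.1.1, lt_of_le_of_ne h2 fun h => h1.2 (by rwa [h])⟩, h1.2⟩
  rw [← prod_coe_sort X fun x => #{y ∈ Ico 1 x | y ∉ X}]
  have : ∏ x : X, #{y ∈ Ico 1 x.1 | y ∉ X} =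
      Nat.card (∀ x : X, ↥((Ico 1 x.1).filter (· ∉ X))) := by
    rw [Nat.card_pi]
    exact prod_congr rfl fun x _ => (Nat.card_eq_fintype_card.trans (Fintype.card_coe _)).symm
  rw [this]
  refine Nat.card_congr (Equiv.ofBijective
    (fun P x => ⟨partMin P.1 x, hmem P.1 P.2 x x.2⟩) ⟨?_, ?_⟩)
  · rintro ⟨P, hP⟩ ⟨Q, hQ⟩ h
    refine Subtype.ext (eq_of_partMin_eq fun x hx => ?_)
    by_cases hxX : x ∈ X
    · exact congrArg Subtype.val (congrFun h ⟨x, hxX⟩)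
    · rw [partMin_eq_self P (by rw [hP]; exact mem_sdiff.2 ⟨hx, hxX⟩),
        partMin_eq_self Q (by rw [hQ]; exact mem_sdiff.2 ⟨hx, hxX⟩)]
  · intro f
    let f' : ℕ → ℕ := fun x => if h : x ∈ X then (f ⟨x, h⟩).1 else x
    have hpos : ∀ x (h : x ∈ X), f' x = (f ⟨x, h⟩).1 := fun x h => dif_pos h
    have hneg : ∀ x, x ∉ X → f' x = x := fun x h => dif_neg h
    have hprop : ∀ x ∈ Icc 1 N, 1 ≤ f' x ∧ f' x ≤ x ∧ f' x ∉ X := by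
      intro x hx
      by_cases h : x ∈ X
      · rw [hpos x h]
        have := (f ⟨x, h⟩).2
        rw [mem_filter, mem_Ico] at this
        exact ⟨this.1.1, this.1.2.le, this.2⟩
      · rw [hneg x h]
        exact ⟨(mem_Icc.1 hx).1, le_rfl, h⟩
    have hIcc : ∀ x ∈ Icc 1 N, f' x ∈ Icc 1 N := fun x hx =>
      mem_Icc.2 ⟨(hprop x hx).1, (hprop x hx).2.1.trans (mem_Icc.1 hx).2⟩
    obtain ⟨P, hP⟩ := exists_finpartition_partMin_eq (N := N) f' hIcc
      (fun x hx => (hprop x hx).2.1) (fun x hx => hneg _ (hprop x hx).2.2)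
    refine ⟨⟨P, ?_⟩, ?_⟩
    · ext y
      rw [mem_mins_blocks, mem_sdiff]
      constructor
      · rintro ⟨x, hx, rfl⟩
        rw [hP x hx]
        exact ⟨hIcc x hx, (hprop x hx).2.2⟩
      · rintro ⟨hy, hyX⟩
        exact ⟨y, hy, by rw [hP y hy, hneg y hyX]⟩
    · funext x
      apply Subtype.ext
      change partMin P x = _
      rw [hP x (hX x.2), hpos x x.2]

end Partitions

/-! ### Permutations with prescribed left-to-right minima -/

/-- The positions (increased by one) of the left-to-right minima of a permutation. -/
def lminPos {N : ℕ} (τ : Equiv.Perm (Fin N)) : Finset ℕ :=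
  ({v : Fin N | ∀ u < v, τ v < τ u} : Finset (Fin N)).image fun v : Fin N => (v : ℕ) + 1

/-- In the graph of a permutation, a left-to-right minimum is a point with no point to its lower
left, a condition symmetric in positions and values. Positions are better suited to induction by
appending a last value. -/
theorem lmin_inv {N : ℕ} (τ : Equiv.Perm (Fin N)) : lmin τ⁻¹ = lminPos τ := by
  have inv_apply_self : ∀ x, τ⁻¹ (τ x) = x := τ.symm_apply_apply
  have apply_inv_self : ∀ x, τ (τ⁻¹ x) = x := τ.apply_symm_apply
  ext y
  simp only [lmin, lminPos, mem_image, mem_filter, mem_univ, true_and]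
  constructor
  · rintro ⟨p, hp, rfl⟩
    refine ⟨τ⁻¹ p, fun u hu => ?_, rfl⟩
    rw [apply_inv_self]
    by_contra! h
    rcases h.lt_or_eq with h | h
    · have := hp _ h
      rw [inv_apply_self] at this
      exact lt_asymm hu this
    · rw [← h, inv_apply_self] at hu
      exact lt_irrefl _ hu
  · rintro ⟨v, hv, rfl⟩
    refine ⟨τ v, fun q hq => ?_, by rw [inv_apply_self]⟩
    rw [inv_apply_self]
    by_contra! h
    rcases h.lt_or_eq with h | h
    · have := hv _ h
      rw [apply_inv_self] at this
      exact lt_asymm hq this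
    · rw [← h, apply_inv_self] at hq
      exact lt_irrefl _ hq

/-- The permutation whose last value is `p` and whose other values are ordered as in `τ`. -/
def snocPerm {N : ℕ} (p : Fin (N + 1)) (τ : Equiv.Perm (Fin N)) : Equiv.Perm (Fin (N + 1)) :=
  (finSuccEquivLast.trans (Equiv.optionCongr τ)).trans (finSuccEquiv' p).symm

@[simp] theorem snocPerm_castSucc {N : ℕ} (p : Fin (N + 1)) (τ : Equiv.Perm (Fin N)) (i : Fin N) :
    snocPerm p τ i.castSucc = p.succAbove (τ i) := by
  simp [snocPerm]

@[simp] theorem snocPerm_last {N : ℕ} (p : Fin (N + 1)) (τ : Equiv.Perm (Fin N)) :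
    snocPerm p τ (Fin.last N) = p := by
  simp [snocPerm]

theorem snocPerm_bijective (N : ℕ) :
    Function.Bijective fun q : Fin (N + 1) × Equiv.Perm (Fin N) => snocPerm q.1 q.2 := by
  rw [Fintype.bijective_iff_injective_and_card]
  constructor
  · rintro ⟨p, τ⟩ ⟨p', τ'⟩ h
    simp only at h
    have hp : p = p' := by rw [← snocPerm_last p τ, h, snocPerm_last]
    subst hp
    refine Prod.ext rfl (Equiv.ext fun i => ?_)
    apply Fin.succAbove_right_injective (p := p)
    rw [← snocPerm_castSucc, h, snocPerm_castSucc]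
  · simp [Fintype.card_perm, Nat.factorial_succ]

theorem lminPos_subset {N : ℕ} (τ : Equiv.Perm (Fin N)) : lminPos τ ⊆ Icc 1 N := by
  intro y hy
  simp only [lminPos, mem_image, mem_filter] at hy
  obtain ⟨v, -, rfl⟩ := hy
  rw [mem_Icc]
  omega

/-- Appending a value preserves the relative order of the others, and the last entry is a
left-to-right minimum only if it is the least value. -/
theorem lminPos_snocPerm {N : ℕ} (p : Fin (N + 1)) (τ : Equiv.Perm (Fin N)) :
    lminPos (snocPerm p τ) = if p = 0 then insert (N + 1) (lminPos τ) else lminPos τ := by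
  have h1 : ∀ v : Fin N, (∀ u < v.castSucc, snocPerm p τ v.castSucc < snocPerm p τ u) ↔
      ∀ u < v, τ v < τ u := by
    intro v
    constructor
    · intro h u hu
      have := h u.castSucc (Fin.castSucc_lt_castSucc_iff.2 hu)
      rw [snocPerm_castSucc, snocPerm_castSucc] at this
      exact Fin.succAbove_lt_succAbove_iff.1 this
    · intro h u hu
      obtain ⟨u, rfl⟩ : ∃ u' : Fin N, u = u'.castSucc := by
        refine ⟨⟨u, ?_⟩, rfl⟩
        have : u.1 < v.1 := hu
        omega
      rw [snocPerm_castSucc, snocPerm_castSucc]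
      exact Fin.succAbove_lt_succAbove_iff.2 (h u (Fin.castSucc_lt_castSucc_iff.1 hu))
  have h2 : (∀ u < Fin.last N, snocPerm p τ (Fin.last N) < snocPerm p τ u) ↔ p = 0 := by
    rw [snocPerm_last]
    constructor
    · intro h
      by_contra hp
      obtain ⟨u, hu⟩ := (snocPerm p τ).surjective 0
      have hul : u ≠ Fin.last N := by
        rintro rfl
        rw [snocPerm_last] at hu
        exact hp hu
      have := h u (Fin.lt_last_iff_ne_last.2 hul)
      rw [hu] at this
      exact absurd this (Fin.not_lt_zero p)
    · rintro rfl u hu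
      rw [Fin.pos_iff_ne_zero]
      intro h
      have : u = Fin.last N := (snocPerm 0 τ).injective (by rw [h, snocPerm_last])
      exact hu.ne this
  have h3 : ∀ y, y ∈ lminPos (snocPerm p τ) ↔ y ∈ lminPos τ ∨ (p = 0 ∧ y = N + 1) := by
    intro y
    simp only [lminPos, mem_image, mem_filter, mem_univ, true_and]
    constructor
    · rintro ⟨v, hv, rfl⟩
      induction v using Fin.lastCases with
      | last => exact Or.inr ⟨h2.1 hv, by simp⟩
      | cast v => exact Or.inl ⟨v, (h1 v).1 hv, by simp⟩
    · rintro (⟨v, hv, rfl⟩ | ⟨hp, rfl⟩)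
      · exact ⟨v.castSucc, (h1 v).2 hv, by simp⟩
      · exact ⟨Fin.last N, h2.2 hp, by simp⟩
  ext y
  rw [h3]
  split_ifs with h <;> simp [h, or_comm]

/-- Induction on the last value: if `N + 1 ∈ X` it is any of the `N` nonzero values, otherwise it
must be 0. -/
theorem card_perm_lminPos_eq {N : ℕ} {X : Finset ℕ} (hX : X ⊆ Icc 1 N) :
    #{τ : Equiv.Perm (Fin N) | lminPos τ = Icc 1 N \ X} = ∏ x ∈ X, (x - 1) := by
  induction N generalizing X with
  | zero =>
    have : X = ∅ := by simpa using hX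
    subst this
    simp [lminPos]
  | succ N ih =>
    have hbij := snocPerm_bijective N
    have hcard : #{τ : Equiv.Perm (Fin (N + 1)) | lminPos τ = Icc 1 (N + 1) \ X} =
        #{q : Fin (N + 1) × Equiv.Perm (Fin N) |
          lminPos (snocPerm q.1 q.2) = Icc 1 (N + 1) \ X} := by
      symm
      refine card_bij (fun q _ => snocPerm q.1 q.2) ?_ ?_ ?_
      · intro q hq; simpa using hq
      · intro q _ q' _ h; exact hbij.1 h
      · intro τ hτ
        obtain ⟨q, rfl⟩ := hbij.2 τ
        exact ⟨q, by simpa using hτ, rfl⟩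
    have hX' : X.erase (N + 1) ⊆ Icc 1 N := by
      intro x hx
      have h := mem_Icc.1 (hX (mem_of_mem_erase hx))
      have := ne_of_mem_erase hx
      rw [mem_Icc]; omega
    have hiff : ∀ q : Fin (N + 1) × Equiv.Perm (Fin N),
        lminPos (snocPerm q.1 q.2) = Icc 1 (N + 1) \ X ↔
          (q.1 = 0 ↔ N + 1 ∉ X) ∧ lminPos q.2 = Icc 1 N \ X.erase (N + 1) := by
      intro q
      have hsub := lminPos_subset q.2
      have hN : N + 1 ∉ lminPos q.2 := fun h => by
        have := mem_Icc.1 (hsub h); omega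
      have e : Icc 1 (N + 1) = insert (N + 1) (Icc 1 N) := by
        ext; simp only [mem_Icc, mem_insert]; omega
      have hN' : N + 1 ∉ Icc 1 N := by simp
      rw [lminPos_snocPerm]
      constructor
      · intro h
        have h1 : (q.1 = 0 ↔ N + 1 ∉ X) := by
          have := congrArg (fun s => N + 1 ∈ s) h
          simp only [eq_iff_iff] at this
          split_ifs at this with h0
          · simpa [h0] using this
          · simpa [h0, hN] using this
        refine ⟨h1, ?_⟩
        ext y
        have h2 := congrArg (fun s => y ∈ s) h
        simp only [eq_iff_iff] at h2
        by_cases hy : y = N + 1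
        · subst hy
          simp [hN]
        · have : y ∈ lminPos q.2 ↔ y ∈ Icc 1 (N + 1) \ X := by
            rw [← h2]; split_ifs <;> simp [hy]
          rw [this, e]
          simp [hy]
      · rintro ⟨h1, h2⟩
        ext y
        by_cases hy : y = N + 1
        · subst hy
          split_ifs with h0
          · simp [h1.1 h0]
          · have : N + 1 ∈ X := by by_contra h; exact h0 (h1.2 h)
            simp [this, hN]
        · have : y ∈ lminPos q.2 ↔ y ∈ Icc 1 (N + 1) \ X := by
            rw [h2, e]
            simp [hy]
          rw [← this]
          split_ifs <;> simp [hy]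
    rw [hcard, filter_congr fun q _ => hiff q, ← univ_product_univ, filter_product
      (p := fun p : Fin (N + 1) => (p = 0 ↔ N + 1 ∉ X))
      (q := fun τ => lminPos τ = Icc 1 N \ X.erase (N + 1)), card_product, ih hX']
    by_cases hmem : N + 1 ∈ X
    · rw [← mul_prod_erase X _ hmem]
      congr 1
      have : ({p : Fin (N + 1) | p = 0 ↔ N + 1 ∉ X} : Finset _) = univ.erase 0 := by
        ext p; simp [hmem]
      rw [this]
      simp
    · rw [erase_eq_of_notMem hmem]
      have : ({p : Fin (N + 1) | p = 0 ↔ N + 1 ∉ X} : Finset _) = {0} := by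
        ext p; simp [hmem]
      rw [this]
      simp

theorem card_perm_lmin_eq {N : ℕ} {X : Finset ℕ} (hX : X ⊆ Icc 1 N) :
    Nat.card {σ : Equiv.Perm (Fin N) // lmin σ = Icc 1 N \ X} = ∏ x ∈ X, (x - 1) := by
  rw [← card_perm_lminPos_eq hX, ← Fintype.card_subtype, ← Nat.card_eq_fintype_card]
  exact (Nat.card_congr ((Equiv.inv _).subtypeEquiv fun τ => by
    rw [Equiv.inv_apply, lmin_inv])).symm

theorem lmin_subset {N : ℕ} (σ : Equiv.Perm (Fin N)) : lmin σ ⊆ Icc 1 N := by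
  rw [← inv_inv σ, lmin_inv]
  exact lminPos_subset _

/-! ### Counting functions -/

/-- A function on `α` is a family of functions on the fibers of `f`, so fiberwise constraints are
independent. -/
theorem card_subtype_forall_fiber {α β : Type*} [Fintype β] (f : α → β)
    (P : ∀ b, ({a // f a = b} → ℕ) → Prop) :
    Nat.card {c : α → ℕ // ∀ b, P b fun a => c a} = ∏ b, Nat.card {c // P b c} := by
  rw [← Nat.card_pi]
  refine Nat.card_congr (Equiv.trans ?_ Equiv.subtypePiEquivPi)
  refine Equiv.subtypeEquiv
    { toFun := fun c b a => c a
      invFun := fun g a => g (f a) ⟨a, rfl⟩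
      left_inv := fun c => rfl
      right_inv := fun g => by
        funext b ⟨a, ha⟩
        subst ha
        rfl } fun c => Iff.rfl

/-- A slack variable at `none` turns the inequality into an equality, counted by multisets of size
`s`. -/
theorem card_fun_sum_le (ι : Type*) [Fintype ι] (s : ℕ) :
    Nat.card {c : ι → ℕ // ∑ i, c i ≤ s} = (Fintype.card ι + s).choose s := by
  classical
  have h1 : Nat.card {c : ι → ℕ // ∑ i, c i ≤ s} =
      Nat.card {c : Option ι → ℕ // ∑ i, c i = s} := by
    refine Nat.card_congr
      { toFun := fun c => ⟨fun i => i.elim (s - ∑ i, c.1 i) c.1, ?_⟩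
        invFun := fun c => ⟨fun i => c.1 (some i), ?_⟩
        left_inv := fun c => rfl
        right_inv := fun c => ?_ }
    · rw [Fintype.sum_option]
      exact Nat.sub_add_cancel c.2
    · have := c.2
      rw [Fintype.sum_option] at this
      change ∑ i, c.1 (some i) ≤ s
      omega
    · apply Subtype.ext
      funext i
      cases i with
      | none =>
        have := c.2
        rw [Fintype.sum_option] at this
        change s - ∑ i, c.1 (some i) = c.1 none
        omega
      | some i => rfl
  rw [h1, ← Nat.card_congr (Sym.equivNatSumOfFintype (Option ι) s), Nat.card_eq_fintype_card,
    Sym.card_sym_eq_choose, Fintype.card_option]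
  congr 1
  omega

theorem card_fun_sum_eq_le_one (ι : Type*) [Fintype ι] (s : ℕ) :
    Nat.card {c : ι → ℕ // ∑ i, c i = s ∧ ∀ i, c i ≤ 1} = (Fintype.card ι).choose s := by
  classical
  rw [← Finset.card_univ, ← card_powersetCard, ← Fintype.card_coe, ← Nat.card_eq_fintype_card]
  symm
  refine Nat.card_congr
    { toFun := fun A => ⟨fun i => if i ∈ A.1 then 1 else 0, ?_, ?_⟩
      invFun := fun c => ⟨univ.filter fun i => c.1 i = 1, ?_⟩
      left_inv := fun A => ?_
      right_inv := fun c => ?_ }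
  · simpa using (mem_powersetCard.1 A.2).2
  · intro i
    dsimp only
    split_ifs <;> simp
  · rw [mem_powersetCard]
    refine ⟨subset_univ _, ?_⟩
    refine Eq.trans ?_ c.2.1
    rw [card_filter]
    refine sum_congr rfl fun i _ => ?_
    have := c.2.2 i
    split_ifs <;> omega
  · apply Subtype.ext
    ext i
    simp
  · apply Subtype.ext
    funext i
    have := c.2.2 i
    simp only [mem_filter, mem_univ, true_and]
    split_ifs <;> omega

/-! ### Segmented families with prescribed minima -/

section Families

variable (N : ℕ) (X : Finset ℕ)

/-- The least element of `insert (N + 1) X` that is greater than `y`. -/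
noncomputable def next (y : ℕ) : ℕ := sInf {z | z ∈ insert (N + 1) X ∧ y < z}

variable {N X}

theorem next_spec {y : ℕ} (hy : y ≤ N) : next N X y ∈ insert (N + 1) X ∧ y < next N X y :=
  Nat.sInf_mem (s := {z | z ∈ insert (N + 1) X ∧ y < z})
    ⟨N + 1, mem_insert_self _ _, Nat.lt_succ_of_le hy⟩

theorem next_le {y z : ℕ} (hz : z ∈ insert (N + 1) X) (h : y < z) : next N X y ≤ z :=
  Nat.sInf_le (s := {z | z ∈ insert (N + 1) X ∧ y < z}) ⟨hz, h⟩

theorem next_eq_iff {y z : ℕ} (hX : X ⊆ Icc 1 N) (hy : y ≤ N) (hyX : y ∉ X)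
    (hz : z ∈ insert (N + 1) X) : next N X y = z ↔ y < z ∧ ∀ x ∈ X, x < z → x < y := by
  constructor
  · rintro rfl
    refine ⟨(next_spec hy).2, fun x hx hlt => ?_⟩
    by_contra! h
    rcases h.eq_or_lt with rfl | h
    · exact hyX hx
    · exact absurd (next_le (N := N) (mem_insert_of_mem hx) h) (by omega)
  · rintro ⟨h1, h2⟩
    refine le_antisymm (next_le hz h1) ?_
    by_contra! h
    obtain ⟨h3, h4⟩ := next_spec (X := X) hy
    rcases mem_insert.1 h3 with h5 | h5
    · have : z ≤ N + 1 := by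
        rcases mem_insert.1 hz with rfl | h
        · exact le_rfl
        · have := mem_Icc.1 (hX h); omega
      omega
    · have := h2 _ h5 h
      omega

/-- The block with minimum `y` of the family determined by `c`. -/
noncomputable def segBlock (c : ↥(Icc 1 N \ X) → ℕ) (y : ↥(Icc 1 N \ X)) : Multiset ℕ :=
  y.1 ::ₘ Multiset.replicate (c y) (next N X y.1)

/-- The family in which the block with minimum `y` contains `c y` copies of the next element
of `insert (N + 1) X`. -/
noncomputable def segFamily (c : ↥(Icc 1 N \ X) → ℕ) : Finset (Multiset ℕ) :=
  univ.image (segBlock c)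

section

variable (c : ↥(Icc 1 N \ X) → ℕ) (y : ↥(Icc 1 N \ X))

theorem coe_le : y.1 ≤ N := (mem_Icc.1 (mem_sdiff.1 y.2).1).2

theorem mem_segBlock {x : ℕ} : x ∈ segBlock c y ↔ x = y.1 ∨ (c y ≠ 0 ∧ x = next N X y.1) := by
  rw [segBlock, Multiset.mem_cons, Multiset.mem_replicate]

theorem blockMin_segBlock : blockMin (segBlock c y) = y.1 := by
  refine blockMin_eq ((mem_segBlock c y).2 (Or.inl rfl)) fun x hx => ?_
  rcases (mem_segBlock c y).1 hx with rfl | ⟨-, rfl⟩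
  · exact le_rfl
  · exact (next_spec (coe_le y)).2.le

theorem segBlock_injective : Function.Injective (segBlock c) := fun y y' h =>
  Subtype.ext (by rw [← blockMin_segBlock c y, h, blockMin_segBlock])

theorem count_segBlock (x : ℕ) : (segBlock c y).count x =
    (if x = y.1 then 1 else 0) + if next N X y.1 = x then c y else 0 := by
  rw [segBlock, Multiset.count_cons, Multiset.count_replicate, add_comm]

theorem mem_segFamily {C : Multiset ℕ} : C ∈ segFamily c ↔ ∃ y, segBlock c y = C := by
  simp [segFamily]

theorem mins_segFamily : mins (segFamily c) = Icc 1 N \ X := by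
  ext x
  rw [mem_mins]
  constructor
  · rintro ⟨C, hC, rfl⟩
    obtain ⟨y, rfl⟩ := (mem_segFamily c).1 hC
    rw [blockMin_segBlock]
    exact y.2
  · intro hx
    exact ⟨_, (mem_segFamily c).2 ⟨⟨x, hx⟩, rfl⟩, blockMin_segBlock c ⟨x, hx⟩⟩

theorem card_segFamily : #(segFamily c) = #(Icc 1 N \ X) := by
  rw [segFamily, card_image_of_injective _ (segBlock_injective c), card_univ, Fintype.card_coe]

theorem zero_notMem_segFamily : 0 ∉ segFamily c := fun h => by
  obtain ⟨y, hy⟩ := (mem_segFamily c).1 h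
  exact Multiset.cons_ne_zero hy

theorem count_sum_segFamily (x : ℕ) : (∑ C ∈ segFamily c, C).count x =
    (if x ∈ Icc 1 N \ X then 1 else 0) + ∑ y : {y : ↥(Icc 1 N \ X) // next N X y.1 = x}, c y := by
  rw [segFamily, sum_image fun y _ y' _ h => segBlock_injective c h, Multiset.count_sum',
    sum_congr rfl fun y _ => count_segBlock c y x, sum_add_distrib]
  congr 1
  · split_ifs with h
    · rw [sum_eq_single_of_mem (⟨x, h⟩ : ↥(Icc 1 N \ X)) (mem_univ _)]
      · simp
      · intro b _ hb
        rw [if_neg]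
        rintro rfl
        exact hb rfl
    · refine sum_eq_zero fun y _ => if_neg ?_
      rintro rfl
      exact h y.2
  · rw [← sum_filter]
    exact sum_subtype _ (by simp) _

theorem isSegmented_segFamily : IsSegmented (Icc 1 (N + 1)) (segFamily c) := by
  rintro x - y hy z - hxy hyz ⟨C, hC, hx, hz⟩
  obtain ⟨m, rfl⟩ := (mem_segFamily c).1 hC
  rw [mins_segFamily]
  rw [mem_segBlock] at hx hz
  have hm := (next_spec (X := X) (coe_le m)).2
  have hx : x = m.1 := by
    rcases hx with h | h <;> rcases hz with h' | h' <;> omega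
  have hz : z = next N X m.1 := by
    rcases hz with h' | h' <;> omega
  by_contra h
  have hyN : y ∈ insert (N + 1) X := by
    rw [mem_Icc] at hy
    rw [mem_sdiff, mem_Icc] at h
    rw [mem_insert]
    by_contra! h'
    exact h ⟨by omega, h'.2⟩
  have := next_le hyN (hx ▸ hxy)
  omega

end

theorem segFamily_injective : Function.Injective (segFamily (N := N) (X := X)) := by
  intro c c' h
  funext y
  have h1 : segBlock c y ∈ segFamily c' := by rw [← h]; exact (mem_segFamily c).2 ⟨y, rfl⟩
  obtain ⟨y', hy'⟩ := (mem_segFamily c').1 h1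
  have : y' = y := Subtype.ext (by rw [← blockMin_segBlock c' y', hy', blockMin_segBlock])
  subst this
  have := congrArg Multiset.card hy'
  simpa [segBlock] using this.symm

theorem insert_eq_sdiff (hX : X ⊆ Icc 1 N) :
    Icc 1 (N + 1) \ (Icc 1 N \ X) = insert (N + 1) X := by
  ext x
  simp only [mem_sdiff, mem_insert, mem_Icc]
  constructor
  · rintro ⟨h1, h2⟩
    by_contra! h
    exact h2 ⟨by omega, h.2⟩
  · rintro (rfl | h)
    · exact ⟨by omega, by omega⟩
    · have := mem_Icc.1 (hX h)
      exact ⟨by omega, fun h' => h'.2 h⟩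

theorem count_ground (hX : X ⊆ Icc 1 N) (t x : ℕ) : (ground t N (Icc 1 N \ X)).count x =
    (if x ∈ Icc 1 N \ X then 1 else 0) + if x ∈ insert (N + 1) X then t - 2 else 0 := by
  rw [ground, insert_eq_sdiff hX, Multiset.count_add, Multiset.count_nsmul,
    Multiset.count_eq_of_nodup (nodup _), Multiset.count_eq_of_nodup (nodup _)]
  simp only [mem_val]
  split_ifs <;> simp

theorem sum_fiber_eq_zero (c : ↥(Icc 1 N \ X) → ℕ) {x : ℕ} (hx : x ∉ insert (N + 1) X) :
    ∑ y : {y : ↥(Icc 1 N \ X) // next N X y.1 = x}, c y = 0 :=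
  sum_eq_zero fun y _ => absurd (next_spec (coe_le y.1)).1 (by rw [y.2]; exact hx)

theorem sum_segFamily_le_ground_iff (hX : X ⊆ Icc 1 N) (t : ℕ) (c : ↥(Icc 1 N \ X) → ℕ) :
    ∑ C ∈ segFamily c, C ≤ ground t N (Icc 1 N \ X) ↔
      ∀ z ∈ insert (N + 1) X,
        ∑ y : {y : ↥(Icc 1 N \ X) // next N X y.1 = z}, c y ≤ t - 2 := by
  rw [Multiset.le_iff_count]
  simp only [count_sum_segFamily, count_ground hX, add_le_add_iff_left]
  refine forall_congr' fun x => ?_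
  by_cases hx : x ∈ insert (N + 1) X
  · simp [hx]
  · simp [hx, sum_fiber_eq_zero c hx]

theorem sum_segFamily_eq_ground_iff (hX : X ⊆ Icc 1 N) (t : ℕ) (c : ↥(Icc 1 N \ X) → ℕ) :
    ∑ C ∈ segFamily c, C = ground t N (Icc 1 N \ X) ↔
      ∀ z ∈ insert (N + 1) X,
        ∑ y : {y : ↥(Icc 1 N \ X) // next N X y.1 = z}, c y = t - 2 := by
  rw [Multiset.ext]
  simp only [count_sum_segFamily, count_ground hX, add_right_inj]
  refine forall_congr' fun x => ?_
  by_cases hx : x ∈ insert (N + 1) X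
  · simp [hx]
  · simp [hx, sum_fiber_eq_zero c hx]

/-- Only the upper bound on multiplicities is used, so this serves both `S` and `s`. The equality of
cardinalities ensures that distinct blocks have distinct minima. -/
theorem exists_eq_segFamily (hX : X ⊆ Icc 1 N) {t : ℕ} {F : Finset (Multiset ℕ)}
    (hmins : mins F = Icc 1 N \ X) (hcard : #F = #(Icc 1 N \ X)) (h0 : 0 ∉ F)
    (hseg : IsSegmented (Icc 1 (N + 1)) F) (hsum : ∑ C ∈ F, C ≤ ground t N (Icc 1 N \ X)) :
    ∃ c, segFamily (N := N) (X := X) c = F := by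
  have hinj : Set.InjOn blockMin (F : Set (Multiset ℕ)) := by
    rw [← card_image_iff]
    change #(mins F) = #F
    rw [hmins, hcard]
  have hex : ∀ y : ↥(Icc 1 N \ X), ∃ C ∈ F, blockMin C = y.1 := fun y =>
    mem_mins.1 (by rw [hmins]; exact y.2)
  choose D hDF hDmin using hex
  have hne : ∀ C ∈ F, C ≠ 0 := fun C hC h => h0 (h ▸ hC)
  have hDmem : ∀ y, y.1 ∈ D y := fun y => by
    have := blockMin_mem (hne _ (hDF y))
    rwa [hDmin] at this
  have hcount : ∀ C ∈ F, ∀ x, C.count x ≤ (ground t N (Icc 1 N \ X)).count x := fun C hC x =>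
    Multiset.count_le_of_le x ((single_le_sum (f := id) (fun _ _ => Multiset.zero_le _) hC).trans
      hsum)
  have hnotZ : ∀ y : ↥(Icc 1 N \ X), y.1 ∉ insert (N + 1) X := fun y h => by
    rcases mem_insert.1 h with h | h
    · have := coe_le y; omega
    · exact (mem_sdiff.1 y.2).2 h
  have hone : ∀ y : ↥(Icc 1 N \ X), (ground t N (Icc 1 N \ X)).count y.1 = 1 := fun y => by
    rw [count_ground hX, if_pos y.2, if_neg (hnotZ y)]
  have hout : ∀ y : ↥(Icc 1 N \ X), ∀ z ∈ D y, z ≠ y.1 → z ∈ insert (N + 1) X := by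
    intro y z hz hzy
    by_contra hzZ
    have hzM : z ∈ Icc 1 N \ X := by
      by_contra hzM
      have h1 := hcount _ (hDF y) z
      rw [count_ground hX, if_neg hzM, if_neg hzZ] at h1
      have := Multiset.count_pos.2 hz
      omega
    -- If `z` is a minimum, its single available copy is already spent in the block with minimum
    -- `z`.
    have hne' : D ⟨z, hzM⟩ ≠ D y := fun h => hzy (by rw [← hDmin y, ← h, hDmin])
    have h2 : ∑ C ∈ {D ⟨z, hzM⟩, D y}, C ≤ ∑ C ∈ F, C :=
      sum_le_sum_of_subset (by
        intro C hC
        rcases mem_insert.1 hC with rfl | hC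
        · exact hDF _
        · rw [mem_singleton.1 hC]; exact hDF _)
    have h3 := Multiset.count_le_of_le z (h2.trans hsum)
    rw [sum_pair hne', Multiset.count_add, hone ⟨z, hzM⟩] at h3
    have h4 := Multiset.count_pos.2 hz
    have h5 := Multiset.count_pos.2 (hDmem ⟨z, hzM⟩)
    simp only at h5
    omega
  have hnext : ∀ y : ↥(Icc 1 N \ X), ∀ z ∈ D y, z ≠ y.1 → z = next N X y.1 := by
    intro y z hz hzy
    have hzZ := hout y z hz hzy
    have hlt : y.1 < z := lt_of_le_of_ne (hDmin y ▸ blockMin_le hz) (Ne.symm hzy)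
    obtain ⟨h1, h2⟩ := next_spec (X := X) (coe_le y)
    refine le_antisymm ?_ (next_le hzZ hlt)
    by_contra! h
    have hZle : ∀ w ∈ insert (N + 1) X, w ∈ Icc 1 (N + 1) := fun w hw => by
      rw [← insert_eq_sdiff hX] at hw
      exact (mem_sdiff.1 hw).1
    have hy := mem_Icc.1 (mem_sdiff.1 y.2).1
    -- Segmentation would make `next N X y.1`, lying strictly between `y` and `z`, a minimum,
    -- although it is in `insert (N + 1) X`.
    have h3 := hseg y.1 (mem_Icc.2 ⟨hy.1, by omega⟩) _ (hZle _ h1) z (hZle _ hzZ) h2 h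
      ⟨D y, hDF y, hDmem y, hz⟩
    rw [hmins] at h3
    exact hnotZ ⟨_, h3⟩ h1
  refine ⟨fun y => (D y).count (next N X y.1), ?_⟩
  have hD : ∀ y, segBlock (fun y => (D y).count (next N X y.1)) y = D y := by
    intro y
    ext x
    rw [count_segBlock]
    have hlt := (next_spec (X := X) (coe_le y)).2
    by_cases h1 : x = y.1
    · have h2 : next N X y.1 ≠ x := by omega
      rw [if_pos h1, if_neg h2, h1]
      have h3 := hcount _ (hDF y) y.1
      rw [hone] at h3
      have := Multiset.count_pos.2 (hDmem y)
      omega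
    · rw [if_neg h1]
      split_ifs with h2
      · rw [h2, zero_add]
      · rw [Multiset.count_eq_zero_of_notMem fun h => h2 (hnext y x h h1).symm]
  ext C
  rw [mem_segFamily]
  constructor
  · rintro ⟨y, rfl⟩
    rw [hD]
    exact hDF y
  · intro hC
    have hm : blockMin C ∈ Icc 1 N \ X := by
      rw [← hmins]; exact mem_mins.2 ⟨C, hC, rfl⟩
    exact ⟨⟨_, hm⟩, by rw [hD]; exact hinj (hDF _) hC (hDmin _)⟩

/-! ### The remaining conditions, read on each fiber of `next` -/

theorem isLeast_iff (hX : X ⊆ Icc 1 N) (hne : X.Nonempty) {z : ℕ} (hz : z ∈ insert (N + 1) X) :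
    IsLeast (↑(Icc 1 N \ (Icc 1 N \ X)) : Set ℕ) z ↔ ¬ ∃ x ∈ X, x < z := by
  rw [Finset.sdiff_sdiff_eq_self hX]
  constructor
  · rintro ⟨-, h⟩ ⟨x, hx, hlt⟩
    exact absurd (h hx) (by omega)
  · intro h
    push Not at h
    refine ⟨?_, fun x hx => h x hx⟩
    rcases mem_insert.1 hz with rfl | h'
    -- The sentinel `N + 1` has no element of `X` below it only when `X` is empty.
    · obtain ⟨x, hx⟩ := hne
      have h1 := mem_Icc.1 (hX hx)
      have h2 := h x hx
      omega
    · exact h'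

theorem next_one_eq (hX : X ⊆ Icc 1 N) (h1 : 1 ∉ X) {z : ℕ} (hz : z ∈ insert (N + 1) X)
    (hN : 1 ≤ N) (h : ¬ ∃ x ∈ X, x < z) : next N X 1 = z := by
  rw [next_eq_iff hX hN h1 hz]
  constructor
  · rcases mem_insert.1 hz with rfl | h'
    · omega
    · have h2 := mem_Icc.1 (hX h')
      have h3 : z ≠ 1 := fun h => h1 (h ▸ h')
      omega
  · intro x hx hlt
    exact absurd ⟨x, hx, hlt⟩ h

/-- As 1 is not in `X`, it lies only in the block with minimum 1, and the next element after it is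
`min X`. The quantified form keeps the condition local to the fiber of `next` over `z`. -/
theorem firstWithOne_segFamily_iff (hX : X ⊆ Icc 1 N) (hne : X.Nonempty) (h1 : 1 ∉ X) (t : ℕ)
    (c : ↥(Icc 1 N \ X) → ℕ) : FirstWithOne t N (segFamily c) ↔
      ∀ z ∈ insert (N + 1) X, (¬ ∃ x ∈ X, x < z) →
        ∀ y : ↥(Icc 1 N \ X), next N X y.1 = z → y.1 = 1 → c y = t - 2 := by
  have hone : ∀ y : ↥(Icc 1 N \ X), 1 ∈ segBlock c y → y.1 = 1 := by
    intro y hy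
    have h2 := mem_Icc.1 (mem_sdiff.1 y.2).1
    rcases (mem_segBlock c y).1 hy with h | h
    · exact h.symm
    · have := (next_spec (X := X) (coe_le y)).2
      omega
  have hN : 1 ≤ N := by
    obtain ⟨x, hx⟩ := hne
    have := mem_Icc.1 (hX hx)
    omega
  rw [FirstWithOne, mins_segFamily]
  constructor
  · intro h z hz hfirst y hyz hy1
    obtain ⟨C, hC, hC1, hCx⟩ := h z ((isLeast_iff hX hne hz).2 hfirst)
    obtain ⟨y', rfl⟩ := (mem_segFamily c).1 hC
    have : y' = y := Subtype.ext ((hone y' hC1).trans hy1.symm)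
    subst this
    rw [count_segBlock, if_pos hyz, if_neg, zero_add] at hCx
    · exact hCx
    · have := (next_spec (X := X) (coe_le y')).2
      omega
  · intro h z hz
    have hzZ : z ∈ insert (N + 1) X := by
      have := hz.1
      rw [Finset.sdiff_sdiff_eq_self hX] at this
      exact mem_insert_of_mem this
    have hfirst := (isLeast_iff hX hne hzZ).1 hz
    let y : ↥(Icc 1 N \ X) := ⟨1, mem_sdiff.2 ⟨mem_Icc.2 ⟨le_rfl, hN⟩, h1⟩⟩
    have hyz : next N X y.1 = z := next_one_eq hX h1 hzZ hN hfirst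
    refine ⟨segBlock c y, (mem_segFamily c).2 ⟨y, rfl⟩, (mem_segBlock c y).2 (Or.inl rfl), ?_⟩
    rw [count_segBlock, if_pos hyz, if_neg, zero_add, h z hzZ hfirst y hyz rfl]
    have := (next_spec (X := X) (coe_le y)).2
    omega

theorem count_segFamily_le_one_iff (hX : X ⊆ Icc 1 N) (hne : X.Nonempty)
    (c : ↥(Icc 1 N \ X) → ℕ) :
    (∀ C ∈ segFamily c, ∀ y ∈ C,
      ¬ IsLeast (↑(Icc 1 N \ (Icc 1 N \ X)) : Set ℕ) y → C.count y ≤ 1) ↔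
      ∀ z ∈ insert (N + 1) X, (∃ x ∈ X, x < z) →
        ∀ y : ↥(Icc 1 N \ X), next N X y.1 = z → c y ≤ 1 := by
  constructor
  · rintro h z hz hfirst y rfl
    by_cases hc : c y = 0
    · omega
    have := h _ ((mem_segFamily c).2 ⟨y, rfl⟩) _ ((mem_segBlock c y).2 (Or.inr ⟨hc, rfl⟩))
      (by rw [isLeast_iff hX hne hz]; exact not_not.2 hfirst)
    rw [count_segBlock, if_pos rfl] at this
    omega
  · intro h C hC x hx hleast
    obtain ⟨y, rfl⟩ := (mem_segFamily c).1 hC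
    have hlt := (next_spec (X := X) (coe_le y)).2
    rw [count_segBlock]
    rcases (mem_segBlock c y).1 hx with rfl | ⟨-, rfl⟩
    · rw [if_pos rfl, if_neg (by omega)]
    · have hz := (next_spec (X := X) (coe_le y)).1
      rw [isLeast_iff hX hne hz, not_not] at hleast
      rw [if_neg (by omega), if_pos rfl, zero_add]
      exact h _ hz hleast y rfl

/-- The number of elements less than `z` that are not separated from `z` by elements of `X`. -/
def gap (X : Finset ℕ) (z : ℕ) : ℕ := #{y ∈ Ico 1 z | ∀ x ∈ X, x < z → x < y}

theorem card_fiber_next (hX : X ⊆ Icc 1 N) {z : ℕ} (hz : z ∈ insert (N + 1) X) :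
    Fintype.card {y : ↥(Icc 1 N \ X) // next N X y.1 = z} = gap X z := by
  rw [gap, ← Fintype.card_coe]
  have hzN : z ≤ N + 1 := by
    rw [← insert_eq_sdiff hX] at hz
    exact (mem_Icc.1 (mem_sdiff.1 hz).1).2
  refine Fintype.card_congr
    { toFun := fun y => ⟨y.1.1, ?_⟩
      invFun := fun y => ⟨⟨y.1, ?_⟩, ?_⟩
      left_inv := fun y => rfl
      right_inv := fun y => rfl }
  · have h1 := mem_sdiff.1 y.1.2
    have h2 := (next_eq_iff hX (coe_le y.1) h1.2 hz).1 y.2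
    exact mem_filter.2 ⟨mem_Ico.2 ⟨(mem_Icc.1 h1.1).1, h2.1⟩, h2.2⟩
  · obtain ⟨h1, h2⟩ := mem_filter.1 y.2
    rw [mem_Ico] at h1
    exact mem_sdiff.2 ⟨mem_Icc.2 ⟨h1.1, by omega⟩, fun h => lt_irrefl _ (h2 _ h h1.2)⟩
  · obtain ⟨h1, h2⟩ := mem_filter.1 y.2
    rw [mem_Ico] at h1
    exact (next_eq_iff hX (by omega) (fun h => lt_irrefl _ (h2 _ h h1.2)) hz).2 ⟨h1.2, h2⟩

theorem eq_single_of_sum_le {ι : Type*} [Fintype ι] [DecidableEq ι] (i : ι) (s : ℕ) {c : ι → ℕ}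
    (h : ∑ j, c j ≤ s) (hi : c i = s) : c = Pi.single i s := by
  funext j
  by_cases hj : j = i
  · subst hj
    rw [hi, Pi.single_eq_same]
  · rw [Pi.single_eq_of_ne hj]
    have := sum_le_sum_of_subset (f := c) (subset_univ {i, j})
    rw [sum_pair (Ne.symm hj)] at this
    omega

/-- The families occurring in the definition of `S`, with complement of the set of minima `X`. -/
def IsSubFamily (t N : ℕ) (X : Finset ℕ) (F : Finset (Multiset ℕ)) : Prop :=
  mins F = Icc 1 N \ X ∧ #F = #(Icc 1 N \ X) ∧ 0 ∉ F ∧ IsSegmented (Icc 1 (N + 1)) F ∧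
    (∑ C ∈ F, C) ≤ ground t N (mins F) ∧ FirstWithOne t N F

/-- The families occurring in the definition of `s`, with complement of the set of minima `X`. -/
def IsFullFamily (t N : ℕ) (X : Finset ℕ) (F : Finset (Multiset ℕ)) : Prop :=
  mins F = Icc 1 N \ X ∧ #F = #(Icc 1 N \ X) ∧ 0 ∉ F ∧ IsSegmented (Icc 1 (N + 1)) F ∧
    (∑ C ∈ F, C) = ground t N (mins F) ∧ FirstWithOne t N F ∧
    ∀ C ∈ F, ∀ y ∈ C, ¬ IsLeast (↑(Icc 1 N \ mins F) : Set ℕ) y → C.count y ≤ 1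

theorem card_subtype_segFamily {Q : Finset (Multiset ℕ) → Prop}
    (hQ : ∀ F, Q F → ∃ c, segFamily (N := N) (X := X) c = F)
    (P : ∀ z : ↥(insert (N + 1) X), ({y : ↥(Icc 1 N \ X) // next N X y.1 = z.1} → ℕ) → Prop)
    (hP : ∀ c : ↥(Icc 1 N \ X) → ℕ, Q (segFamily c) ↔ ∀ z, P z fun y => c y) :
    Nat.card {F // Q F} = ∏ z, Nat.card {c // P z c} := by
  have h1 := card_subtype_forall_fiber
    (fun y : ↥(Icc 1 N \ X) => (⟨next N X y.1, (next_spec (coe_le y)).1⟩ : ↥(insert (N + 1) X)))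
    (fun z c => P z fun y => c ⟨y.1, Subtype.ext y.2⟩)
  have h2 : ∀ z : ↥(insert (N + 1) X), Nat.card {c : {y : ↥(Icc 1 N \ X) //
      (⟨next N X y.1, (next_spec (coe_le y)).1⟩ : ↥(insert (N + 1) X)) = z} → ℕ //
        P z fun y => c ⟨y.1, Subtype.ext y.2⟩} = Nat.card {c // P z c} := by
    intro z
    refine Nat.card_congr
      { toFun := fun c => ⟨_, c.2⟩
        invFun := fun c => ⟨fun y => c.1 ⟨y.1, congrArg Subtype.val y.2⟩, c.2⟩
        left_inv := fun c => rfl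
        right_inv := fun c => rfl }
  rw [← prod_congr rfl fun z _ => h2 z, ← h1]
  symm
  refine Nat.card_congr (Equiv.ofBijective (fun c => ⟨segFamily c.1, (hP c.1).2 c.2⟩) ⟨?_, ?_⟩)
  · intro c c' h
    exact Subtype.ext (segFamily_injective (congrArg Subtype.val h))
  · rintro ⟨F, hF⟩
    obtain ⟨c, rfl⟩ := hQ F hF
    exact ⟨⟨c, (hP c).1 hF⟩, rfl⟩

theorem card_isSubFamily (hX : X ⊆ Icc 1 N) (hne : X.Nonempty) (h1 : 1 ∉ X) (t : ℕ) :
    Nat.card {F // IsSubFamily t N X F} =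
      ∏ z ∈ insert (N + 1) X,
        if ∃ x ∈ X, x < z then (gap X z + (t - 2)).choose (t - 2) else 1 := by
  classical
  have hN : 1 ≤ N := by
    obtain ⟨x, hx⟩ := hne
    have := mem_Icc.1 (hX hx)
    omega
  rw [card_subtype_segFamily (N := N) (X := X) (Q := IsSubFamily t N X) ?_
    (fun z c => ∑ y, c y ≤ t - 2 ∧
      ((¬ ∃ x ∈ X, x < z.1) → ∀ y, y.1.1 = 1 → c y = t - 2)) ?_]
  · rw [← prod_coe_sort (insert (N + 1) X) (fun z => if ∃ x ∈ X, x < z then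
      (gap X z + (t - 2)).choose (t - 2) else 1)]
    refine prod_congr rfl fun z _ => ?_
    split_ifs with hz
    · rw [← card_fiber_next hX z.2, ← card_fun_sum_le]
      refine Nat.card_congr (Equiv.subtypeEquivRight fun c => ?_)
      simp [hz]
    · let y : ↥(Icc 1 N \ X) := ⟨1, mem_sdiff.2 ⟨mem_Icc.2 ⟨le_rfl, hN⟩, h1⟩⟩
      have hyz : next N X y.1 = z := next_one_eq hX h1 z.2 hN hz
      rw [Nat.card_eq_one_iff_exists]
      -- Over `min X`, the element 1 uses the entire allowance `t - 2`, so all other multiplicities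
      -- vanish and the factor is 1.
      refine ⟨⟨Pi.single ⟨y, hyz⟩ (t - 2), by simp, fun _ y' hy' => ?_⟩, ?_⟩
      · have : y' = ⟨y, hyz⟩ := Subtype.ext (Subtype.ext hy')
        rw [this, Pi.single_eq_same]
      · rintro ⟨c, hc⟩
        exact Subtype.ext (eq_single_of_sum_le _ _ hc.1 (hc.2 hz ⟨y, hyz⟩ rfl))
  · rintro F ⟨h2, h3, h4, h5, h6, -⟩
    rw [h2] at h6
    exact exists_eq_segFamily hX h2 h3 h4 h5 h6
  · intro c
    rw [IsSubFamily, firstWithOne_segFamily_iff hX hne h1, mins_segFamily,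
      sum_segFamily_le_ground_iff hX]
    constructor
    · rintro ⟨-, -, -, -, h2, h3⟩ z
      exact ⟨h2 z z.2, fun h y hy => h3 z z.2 h y.1 y.2 hy⟩
    · intro h
      exact ⟨rfl, card_segFamily c, zero_notMem_segFamily c, isSegmented_segFamily c,
        fun z hz => (h ⟨z, hz⟩).1, fun z hz h' y hy hy1 => (h ⟨z, hz⟩).2 h' ⟨y, hy⟩ hy1⟩

theorem card_isFullFamily (hX : X ⊆ Icc 1 N) (hne : X.Nonempty) (h1 : 1 ∉ X) (t : ℕ) :
    Nat.card {F // IsFullFamily t N X F} =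
      ∏ z ∈ insert (N + 1) X, if ∃ x ∈ X, x < z then (gap X z).choose (t - 2) else 1 := by
  classical
  have hN : 1 ≤ N := by
    obtain ⟨x, hx⟩ := hne
    have := mem_Icc.1 (hX hx)
    omega
  rw [card_subtype_segFamily (N := N) (X := X) (Q := IsFullFamily t N X) ?_
    (fun z c => ∑ y, c y = t - 2 ∧
      ((¬ ∃ x ∈ X, x < z.1) → ∀ y, y.1.1 = 1 → c y = t - 2) ∧
      ((∃ x ∈ X, x < z.1) → ∀ y, c y ≤ 1)) ?_]
  · rw [← prod_coe_sort (insert (N + 1) X) (fun z => if ∃ x ∈ X, x < z then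
      (gap X z).choose (t - 2) else 1)]
    refine prod_congr rfl fun z _ => ?_
    split_ifs with hz
    · rw [← card_fiber_next hX z.2, ← card_fun_sum_eq_le_one]
      refine Nat.card_congr (Equiv.subtypeEquivRight fun c => ?_)
      simp [hz]
    · let y : ↥(Icc 1 N \ X) := ⟨1, mem_sdiff.2 ⟨mem_Icc.2 ⟨le_rfl, hN⟩, h1⟩⟩
      have hyz : next N X y.1 = z := next_one_eq hX h1 z.2 hN hz
      rw [Nat.card_eq_one_iff_exists]
      refine ⟨⟨Pi.single ⟨y, hyz⟩ (t - 2), by simp, fun _ y' hy' => ?_,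
        fun h => absurd h hz⟩, ?_⟩
      · have : y' = ⟨y, hyz⟩ := Subtype.ext (Subtype.ext hy')
        rw [this, Pi.single_eq_same]
      · rintro ⟨c, hc⟩
        exact Subtype.ext (eq_single_of_sum_le _ _ hc.1.le (hc.2.1 hz ⟨y, hyz⟩ rfl))
  · rintro F ⟨h2, h3, h4, h5, h6, -⟩
    rw [h2] at h6
    exact exists_eq_segFamily hX h2 h3 h4 h5 h6.le
  · intro c
    rw [IsFullFamily, firstWithOne_segFamily_iff hX hne h1, mins_segFamily,
      sum_segFamily_eq_ground_iff hX, count_segFamily_le_one_iff hX hne]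
    constructor
    · rintro ⟨-, -, -, -, h2, h3, h4⟩ z
      exact ⟨h2 z z.2, fun h y hy => h3 z z.2 h y.1 y.2 hy, fun h y => h4 z z.2 h y.1 y.2⟩
    · intro h
      exact ⟨rfl, card_segFamily c, zero_notMem_segFamily c, isSegmented_segFamily c,
        fun z hz => (h ⟨z, hz⟩).1, fun z hz h' y hy hy1 => (h ⟨z, hz⟩).2.1 h' ⟨y, hy⟩ hy1,
        fun z hz h' y hy => (h ⟨z, hz⟩).2.2 h' ⟨y, hy⟩⟩

end Families

/-! ### Summation over the complements of the sets of minima -/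

/-- The subsets are sorted by their largest element `i + 1`. -/
theorem sum_powersetCard_succ_Icc {R : Type*} [AddCommMonoid R] (f : Finset ℕ → R) (n N : ℕ) :
    ∑ X ∈ powersetCard (n + 1) (Icc 1 N), f X =
      ∑ i ∈ range N, ∑ X ∈ powersetCard n (Icc 1 i), f (insert (i + 1) X) := by
  induction N with
  | zero => rw [powersetCard_eq_empty.2 (by simp)]; simp
  | succ N ih =>
    have e : Icc 1 (N + 1) = insert (N + 1) (Icc 1 N) := by
      ext; simp only [mem_Icc, mem_insert]; omega
    have hN : N + 1 ∉ Icc 1 N := by simp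
    have hnot : ∀ {k : ℕ} {X}, X ∈ powersetCard k (Icc 1 N) → N + 1 ∉ X := fun hX h =>
      hN ((mem_powersetCard.1 hX).1 h)
    rw [e, powersetCard_succ_insert hN, sum_union, ih, sum_range_succ, sum_image]
    · intro X hX Y hY h
      rw [← erase_insert (hnot hX), ← erase_insert (hnot hY)]
      exact congrArg (fun s => erase s (N + 1)) h
    · rw [disjoint_left]
      intro X hX hX'
      obtain ⟨Y, -, rfl⟩ := mem_image.1 hX'
      exact hnot hX (mem_insert_self _ _)

/-- The contribution to the weight of `X ⊆ {1, …, N}` of the gaps between the elements of `X`. -/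
def gapWeight (h : ℕ → ℕ) (N : ℕ) (X : Finset ℕ) : ℕ :=
  ∏ z ∈ insert (N + 1) X, if ∃ x ∈ X, x < z then h (gap X z) else 1

theorem gapWeight_empty (h : ℕ → ℕ) (N : ℕ) : gapWeight h N ∅ = 1 := by
  simp [gapWeight]

/-- The elements `i + 2, …, N` form the last gap, and `i + 1` takes the role of the sentinel for `X
⊆ {1, …, i}`. -/
theorem gapWeight_insert (h : ℕ → ℕ) {i N : ℕ} (hi : i < N) {X : Finset ℕ} (hX : X ⊆ Icc 1 i) :
    gapWeight h N (insert (i + 1) X) = h (N - 1 - i) * gapWeight h i X := by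
  have hle : ∀ z ∈ insert (i + 1) X, z ≤ i + 1 := by
    intro z hz
    rcases mem_insert.1 hz with rfl | hz
    · exact le_rfl
    · have := mem_Icc.1 (hX hz); omega
  have hN : N + 1 ∉ insert (i + 1) X := fun h => by have := hle _ h; omega
  rw [gapWeight, prod_insert hN, gapWeight]
  congr 1
  · rw [if_pos ⟨i + 1, mem_insert_self _ _, by omega⟩]
    congr 1
    have : ({y ∈ Ico 1 (N + 1) | ∀ x ∈ insert (i + 1) X, x < N + 1 → x < y} : Finset ℕ) =
        Ico (i + 2) (N + 1) := by
      ext y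
      rw [mem_filter, mem_Ico, mem_Ico]
      constructor
      · rintro ⟨h1, h2⟩
        have := h2 (i + 1) (mem_insert_self _ _) (by omega)
        omega
      · rintro ⟨h1, h2⟩
        refine ⟨⟨by omega, h2⟩, fun x hx _ => ?_⟩
        have := hle x hx
        omega
    rw [gap, this, Nat.card_Ico]
    omega
  · refine prod_congr rfl fun z hz => ?_
    have h1 : (∃ x ∈ insert (i + 1) X, x < z) ↔ ∃ x ∈ X, x < z := by
      constructor
      · rintro ⟨x, hx, hlt⟩
        rcases mem_insert.1 hx with rfl | hx
        · have := hle z hz; omega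
        · exact ⟨x, hx, hlt⟩
      · rintro ⟨x, hx, hlt⟩
        exact ⟨x, mem_insert_of_mem hx, hlt⟩
    have h2 : gap (insert (i + 1) X) z = gap X z := by
      unfold gap
      congr 1
      refine filter_congr fun y _ => ?_
      constructor
      · exact fun h x hx => h x (mem_insert_of_mem hx)
      · intro h x hx hlt
        rcases mem_insert.1 hx with rfl | hx
        · have := hle z hz; omega
        · exact h x hx hlt
    simp only [h1, h2]

theorem prod_card_notMem_insert {i : ℕ} {X : Finset ℕ} (hX : X ⊆ Icc 1 i) :
    ∏ x ∈ insert (i + 1) X, #{y ∈ Ico 1 x | y ∉ insert (i + 1) X} =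
      (i - #X) * ∏ x ∈ X, #{y ∈ Ico 1 x | y ∉ X} := by
  have hi : i + 1 ∉ X := fun h => by have := mem_Icc.1 (hX h); omega
  have key : ∀ x ≤ i + 1, ({y ∈ Ico 1 x | y ∉ insert (i + 1) X} : Finset ℕ) =
      {y ∈ Ico 1 x | y ∉ X} := by
    intro x hx
    refine filter_congr fun y hy => ?_
    rw [mem_Ico] at hy
    rw [mem_insert, not_or]
    exact ⟨fun h => h.2, fun h => ⟨by omega, h⟩⟩
  rw [prod_insert hi, key _ le_rfl]
  congr 1
  · have : ({y ∈ Ico 1 (i + 1) | y ∉ X} : Finset ℕ) = Icc 1 i \ X := by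
      ext y
      simp only [mem_filter, mem_Ico, mem_sdiff, mem_Icc, Nat.lt_succ_iff]
    rw [this, card_sdiff_of_subset hX, Nat.card_Icc]
    omega
  · refine prod_congr rfl fun x hx => ?_
    rw [key]
    have := mem_Icc.1 (hX hx)
    omega

/-- The weighted sum counting the tuples in the definition of `S`. -/
def sumS (h : ℕ → ℕ) (a n N : ℕ) : ℕ :=
  ∑ X ∈ powersetCard n (Icc 1 N), gapWeight h N X * (∏ x ∈ X, #{y ∈ Ico 1 x | y ∉ X}) ^ a

/-- The weighted sum counting the tuples in the definition of `s`. -/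
def sumSmall (h : ℕ → ℕ) (a n N : ℕ) : ℕ :=
  ∑ X ∈ powersetCard n (Icc 1 N), gapWeight h N X * (∏ x ∈ X, (x - 1)) ^ a

theorem sumS_zero (h : ℕ → ℕ) (a N : ℕ) : sumS h a 0 N = 1 := by
  simp [sumS, gapWeight_empty]

theorem sumSmall_zero (h : ℕ → ℕ) (a N : ℕ) : sumSmall h a 0 N = 1 := by
  simp [sumSmall, gapWeight_empty]

theorem sumS_succ (h : ℕ → ℕ) (a n N : ℕ) : sumS h a (n + 1) N =
    ∑ i ∈ range N, (i - n) ^ a * h (N - 1 - i) * sumS h a n i := by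
  rw [sumS, sum_powersetCard_succ_Icc]
  refine sum_congr rfl fun i hi => ?_
  rw [sumS, mul_sum]
  refine sum_congr rfl fun X hX => ?_
  obtain ⟨h1, h2⟩ := mem_powersetCard.1 hX
  rw [gapWeight_insert h (mem_range.1 hi) h1, prod_card_notMem_insert h1, h2, mul_pow]
  ring

theorem sumSmall_succ (h : ℕ → ℕ) (a n N : ℕ) : sumSmall h a (n + 1) N =
    ∑ i ∈ range N, i ^ a * h (N - 1 - i) * sumSmall h a n i := by
  rw [sumSmall, sum_powersetCard_succ_Icc]
  refine sum_congr rfl fun i hi => ?_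
  rw [sumSmall, mul_sum]
  refine sum_congr rfl fun X hX => ?_
  have h1 := (mem_powersetCard.1 hX).1
  rw [gapWeight_insert h (mem_range.1 hi) h1, prod_insert fun h => by
    have := mem_Icc.1 (h1 h); omega, mul_pow, Nat.add_sub_cancel]
  ring

theorem sumS_eq_coeff (a s n m : ℕ) :
    (sumS (fun d => (d + s).choose s) (a + 1) n (n + m) : ℚ) =
      PowerSeries.coeff m (desSeries (periodicList a (s + 2) n)) := by
  induction n generalizing m with
  | zero => simp [sumS_zero, periodicList, coeff_desSeries_nil]
  | succ n ih =>
    rw [periodicList_succ, coeff_desSeries_block, Nat.sum_antidiagonal_eq_sum_range_succ_mk,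
      -- The terms with `i < n` vanish, since `i - n` is truncated to 0 and the exponent is
      -- positive; the others match the convolution after a shift by `n`.
      sumS_succ, show n + 1 + m = n + (m + 1) by omega, sum_range_add, sum_eq_zero, zero_add]
    · push_cast
      refine sum_congr rfl fun i hi => ?_
      rw [ih, Nat.add_sub_cancel_left, show n + (m + 1) - 1 - (n + i) = m - i by omega]
    · intro i hi
      rw [Nat.sub_eq_zero_of_le (mem_range.1 hi).le, zero_pow (by omega), zero_mul, zero_mul]

/-- The case `n = m = 0` must be excluded: the empty sum count is 1, while the series `X / (1 - X)`
has constant coefficient 0. -/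
theorem sumSmall_eq_coeff (a s n m : ℕ) (h : 0 < n + m) :
    (sumSmall (fun d => d.choose s) (a + 1) n m : ℚ) =
      PowerSeries.coeff m (desSeriesRev (periodicList a (s + 2) n)) := by
  induction n generalizing m with
  | zero =>
    obtain ⟨m, rfl⟩ : ∃ r, m = r + 1 := ⟨m - 1, by omega⟩
    simp [sumSmall_zero, periodicList, coeff_succ_desSeriesRev_nil]
  | succ n ih =>
    rw [periodicList_succ, sumSmall_succ]
    cases m with
    | zero => rw [coeff_zero_desSeriesRev_block]; simp
    | succ m =>
      rw [coeff_succ_desSeriesRev_block, Nat.sum_antidiagonal_eq_sum_range_succ_mk]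
      push_cast
      refine sum_congr rfl fun i hi => ?_
      cases i with
      -- The factor `0 ^ (a + 1)` vanishes, which avoids the excluded case of the induction
      -- hypothesis.
      | zero => simp
      | succ i => rw [ih _ (by omega)]

/-! ### The tuples in the definitions of `S` and `s` -/

/-- The first component determines `e X`, hence `X`, so the tuples split disjointly over `E`; for
fixed `X` the components are independent. -/
theorem card_tuples {Φ Ψ : Type*} [Finite Ψ] (a : ℕ) (I : Finset ℕ → Φ → Prop)
    (μ : Φ → Finset ℕ) (ρ : Ψ → Finset ℕ) (E : Finset (Finset ℕ)) (e : Finset ℕ → Finset ℕ)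
    (he : Set.InjOn e E) (hI : ∀ X F, I X F → μ F = e X) (hfin : ∀ X, Finite {F // I X F}) :
    Set.ncard {p : Φ × (Fin a → Ψ) | ∃ X ∈ E, I X p.1 ∧ ∀ j, ρ (p.2 j) = e X} =
      ∑ X ∈ E, Nat.card {F // I X F} * Nat.card {P // ρ P = e X} ^ a := by
  have h1 : ∀ X, Nat.card {F // I X F} * Nat.card {P // ρ P = e X} ^ a =
      Nat.card ({F // I X F} × (Fin a → {P // ρ P = e X})) := by
    intro X
    rw [Nat.card_prod, Nat.card_fun, Nat.card_fin]
  simp only [h1]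
  rw [← sum_coe_sort E fun X => Nat.card ({F // I X F} × (Fin a → {P // ρ P = e X})),
    ← Nat.card_sigma (β := fun X : E => {F // I X.1 F} × (Fin a → {P // ρ P = e X.1}))]
  rw [← Nat.card_coe_set_eq]
  symm
  refine Nat.card_congr (Equiv.ofBijective
    (fun q => ⟨(q.2.1.1, fun j => (q.2.2 j).1), q.1.1, q.1.2, q.2.1.2, fun j => (q.2.2 j).2⟩)
    ⟨?_, ?_⟩)
  · rintro ⟨⟨X, hX⟩, ⟨F, hF⟩, f⟩ ⟨⟨X', hX'⟩, ⟨F', hF'⟩, f'⟩ h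
    have h := congrArg Subtype.val h
    rw [Prod.mk.injEq] at h
    obtain ⟨h2, h3⟩ := h
    change F = F' at h2
    subst h2
    have hXX : X = X' := he hX hX' (by rw [← hI X F hF, hI X' F hF'])
    subst hXX
    have : f = f' := funext fun j => Subtype.ext (congrFun h3 j)
    subst this
    rfl
  · rintro ⟨⟨F, f⟩, X, hX, hF, hf⟩
    exact ⟨⟨⟨X, hX⟩, ⟨F, hF⟩, fun j => ⟨f j, hf j⟩⟩, rfl⟩

theorem finite_subtype_of_sum_le {Q : Finset (Multiset ℕ) → Prop} (A : Multiset ℕ)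
    (h : ∀ F, Q F → ∑ C ∈ F, C ≤ A) : Finite {F // Q F} := by
  refine Set.Finite.to_subtype (s := {F | Q F})
    ((A.powerset.toFinset.powerset.finite_toSet).subset fun F hF => ?_)
  rw [mem_coe, mem_powerset]
  intro C hC
  rw [Multiset.mem_toFinset, Multiset.mem_powerset]
  exact (single_le_sum (f := id) (fun _ _ => Multiset.zero_le _) hC).trans (h F hF)

theorem injOn_sdiff (n N : ℕ) :
    Set.InjOn (fun X => Icc 1 N \ X) (powersetCard n (Icc 1 N) : Set (Finset ℕ)) := by
  intro X hX Y hY h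
  rw [← Finset.sdiff_sdiff_eq_self (mem_powersetCard.1 hX).1,
    ← Finset.sdiff_sdiff_eq_self (mem_powersetCard.1 hY).1]
  exact congrArg (fun s => Icc 1 N \ s) h

theorem card_Icc_sdiff {n N : ℕ} {X : Finset ℕ} (hX : X ∈ powersetCard n (Icc 1 N)) :
    #(Icc 1 N \ X) + n = N := by
  obtain ⟨h1, h2⟩ := mem_powersetCard.1 hX
  have := card_sdiff_add_card_eq_card h1
  rw [h2, Nat.card_Icc] at this
  omega

theorem S_eq_sumS {a t n m : ℕ} (ha : 0 < a) (hn : 0 < n) :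
    S a t (n + m) m = sumS (fun d => (d + (t - 2)).choose (t - 2)) a n (n + m) := by
  have hset : {p : Finset (Multiset ℕ) × (Fin a → Finpartition (Icc 1 (n + m))) |
      (∀ j, #(p.2 j).parts = m) ∧ (∀ j, mins (blocks (p.2 j)) = mins p.1) ∧
      #p.1 = m ∧ 0 ∉ p.1 ∧ IsSegmented (Icc 1 (n + m + 1)) p.1 ∧
      (∑ C ∈ p.1, C) ≤ ground t (n + m) (mins p.1) ∧ FirstWithOne t (n + m) p.1} =
      {p | ∃ X ∈ powersetCard n (Icc 1 (n + m)), IsSubFamily t (n + m) X p.1 ∧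
        ∀ j, mins (blocks (p.2 j)) = Icc 1 (n + m) \ X} := by
    ext ⟨F, P⟩
    simp only [Set.mem_ofPred_eq]
    constructor
    · rintro ⟨h1, h2, h3, h4, h5, h6, h7⟩
      have hsub : mins F ⊆ Icc 1 (n + m) := by
        rw [← h2 ⟨0, ha⟩]; exact mins_blocks_subset _
      have hcard : #(mins F) = m := by rw [← h2 ⟨0, ha⟩, card_mins_blocks, h1]
      have hX := Finset.sdiff_sdiff_eq_self hsub
      refine ⟨Icc 1 (n + m) \ mins F, mem_powersetCard.2 ⟨sdiff_subset, ?_⟩,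
        ⟨hX.symm, ?_, h4, h5, h6, h7⟩, fun j => ?_⟩
      · rw [card_sdiff_of_subset hsub, hcard, Nat.card_Icc]; omega
      · rw [hX, h3, hcard]
      · rw [hX, h2]
    · rintro ⟨X, hX, ⟨h1, h2, h3, h4, h5, h6⟩, h7⟩
      have := card_Icc_sdiff hX
      refine ⟨fun j => ?_, fun j => by rw [h7, h1], by omega, h3, h4, h5, h6⟩
      rw [← card_mins_blocks, h7]
      omega
  rw [S, hset, card_tuples a (IsSubFamily t (n + m)) mins (fun P => mins (blocks P)) _
    (fun X => Icc 1 (n + m) \ X) (injOn_sdiff n _) (fun X F h => h.1)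
    fun X => finite_subtype_of_sum_le (ground t (n + m) (Icc 1 (n + m) \ X)) fun F h => by
      have := h.2.2.2.2.1
      rwa [h.1] at this]
  refine sum_congr rfl fun X hX => ?_
  obtain ⟨h1, h2⟩ := mem_powersetCard.1 hX
  rw [card_finpartition_mins_eq h1]
  -- If 1 is not a minimum, no partition exists; as `a > 0`, both terms vanish and the families need
  -- not be counted.
  by_cases hone : 1 ∈ X
  · rw [prod_eq_zero hone (by simp), zero_pow ha.ne', mul_zero, mul_zero]
  · rw [card_isSubFamily h1 (card_pos.1 (by omega)) hone, gapWeight]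

theorem s_eq_sumSmall {a t n m : ℕ} (ha : 0 < a) (hn : 0 < n) :
    s a t m ((m : ℤ) - (n : ℤ)) = sumSmall (fun d => d.choose (t - 2)) a n m := by
  have hset : {p : Finset (Multiset ℕ) × (Fin a → Equiv.Perm (Fin m)) |
      (∀ j, (#(lmin (p.2 j)) : ℤ) = (m : ℤ) - (n : ℤ)) ∧ (∀ j, lmin (p.2 j) = mins p.1) ∧
      (#p.1 : ℤ) = (m : ℤ) - (n : ℤ) ∧ 0 ∉ p.1 ∧ IsSegmented (Icc 1 (m + 1)) p.1 ∧
      (∑ C ∈ p.1, C) = ground t m (mins p.1) ∧ FirstWithOne t m p.1 ∧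
      ∀ C ∈ p.1, ∀ y ∈ C, ¬ IsLeast (↑(Icc 1 m \ mins p.1) : Set ℕ) y → C.count y ≤ 1} =
      {p | ∃ X ∈ powersetCard n (Icc 1 m), IsFullFamily t m X p.1 ∧
        ∀ j, lmin (p.2 j) = Icc 1 m \ X} := by
    ext ⟨F, P⟩
    simp only [Set.mem_ofPred_eq]
    constructor
    · rintro ⟨h1, h2, h3, h4, h5, h6, h7, h8⟩
      have hsub : mins F ⊆ Icc 1 m := by
        rw [← h2 ⟨0, ha⟩]; exact lmin_subset _
      have hcard : (#(mins F) : ℤ) = (m : ℤ) - (n : ℤ) := by rw [← h2 ⟨0, ha⟩, h1]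
      have hX := Finset.sdiff_sdiff_eq_self hsub
      refine ⟨Icc 1 m \ mins F, mem_powersetCard.2 ⟨sdiff_subset, ?_⟩,
        ⟨hX.symm, ?_, h4, h5, h6, h7, h8⟩, fun j => ?_⟩
      · rw [card_sdiff_of_subset hsub, Nat.card_Icc]; omega
      · rw [hX]; omega
      · rw [hX, h2]
    · rintro ⟨X, hX, ⟨h1, h2, h3, h4, h5, h6, h7⟩, h8⟩
      have := card_Icc_sdiff hX
      refine ⟨fun j => ?_, fun j => by rw [h8, h1], by omega, h3, h4, h5, h6, h7⟩
      rw [h8]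
      omega
  rw [s, hset, card_tuples a (IsFullFamily t m) mins lmin _
    (fun X => Icc 1 m \ X) (injOn_sdiff n _) (fun X F h => h.1)
    fun X => finite_subtype_of_sum_le (ground t m (Icc 1 m \ X)) fun F h => by
      have := h.2.2.2.2.1.le
      rwa [h.1] at this]
  refine sum_congr rfl fun X hX => ?_
  obtain ⟨h1, h2⟩ := mem_powersetCard.1 hX
  rw [card_perm_lmin_eq h1]
  by_cases hone : 1 ∈ X
  -- The factor `x - 1` at `x = 1` is 0, as 1 is always a left-to-right minimum.
  · rw [prod_eq_zero hone (by simp), zero_pow ha.ne', mul_zero, mul_zero]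
  · rw [card_isFullFamily h1 (card_pos.1 (by omega)) hone, gapWeight]

end StirlingPoly

theorem corollary4 (k : List ℕ) (n a t : ℕ) (hn : 1 ≤ n)
    (hk : StirlingPoly.HasWeight k (fun _ : Fin n => a) (fun _ : Fin n => t) 0) (m : ℕ) :
    StirlingPoly.B k m = (StirlingPoly.S a t (n + m) m : ℚ) ∧
      StirlingPoly.b k m = (StirlingPoly.s a t m ((m : ℤ) - (n : ℤ)) : ℚ) := by
  obtain ⟨hat, hk⟩ := hk
  have ha : 0 < a := (hat ⟨0, hn⟩).1
  have ht : 1 < t := (hat ⟨0, hn⟩).2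
  obtain ⟨a, rfl⟩ : ∃ a', a = a' + 1 := ⟨a - 1, by omega⟩
  obtain ⟨t, rfl⟩ : ∃ t', t = t' + 2 := ⟨t - 2, by omega⟩
  have hk : k = StirlingPoly.periodicList a (t + 2) n := by
    rw [hk, List.ofFn_const]
    simp [StirlingPoly.periodicList]
  have hpos : ∀ x ∈ k, 0 < x := by
    rw [hk]; exact StirlingPoly.pos_of_mem_periodicList (by omega)
  have hne : k ≠ [] := by
    obtain ⟨n, rfl⟩ : ∃ n', n = n' + 1 := ⟨n - 1, by omega⟩
    rw [hk, StirlingPoly.periodicList_succ]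
    simp
  constructor
  · rw [StirlingPoly.B, StirlingPoly.G_eq_desSeries hpos hne, hk, StirlingPoly.S_eq_sumS ha hn,
      Nat.add_sub_cancel, StirlingPoly.sumS_eq_coeff]
  · rw [StirlingPoly.b, StirlingPoly.g_eq_desSeriesRev hpos hne, hk,
      StirlingPoly.s_eq_sumSmall ha hn, Nat.add_sub_cancel,
      StirlingPoly.sumSmall_eq_coeff _ _ _ _ (by omega)]
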